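/- Let $(\mathbf X_t)_{t\in\mathbb Z}$ be a strictly stationary sequence of $\mathbb R^d$-valued random vectors, $|\cdot|$ the Euclidean norm, $\overline{\mathbb R}=[-\infty,\infty]$, $\overline{\mathbb R}{}_0^{k}=\overline{\mathbb R}{}^{k}\setminus\{\mathbf 0\}$, and $\mathbf Y_h=\mathrm{vec}(\mathbf X_1,\dots,\mathbf X_h)$. Assume that $(\mathbf X_t)$ is regularly varying with index $\alpha>0$: for every $h\ge1$ there is a non-null Radon measure $\mu_h$ on $\overline{\mathbb R}{}_0^{hd}$ with $\mu_h(tB)=t^{-\alpha}\mu_h(B)$ for all $t>0$ and all Borel sets $B$, such that, as $x\to\infty$, $$\frac{P(x^{-1}\mathbf Y_h\in\cdot)}{P(|\mathbf Y_h|>x)}\xrightarrow{v}\mu_h(\cdot)\quad\text{(vague convergence on }\overline{\mathbb R}{}_0^{hd}).$$ Let $\mu=\mu_1$, and let $(a_n)$ be a real sequence with $nP(|\mathbf X_0|>a_n)\to1$. Let $$\alpha_h=\sup_{s\in\mathbb Z}\ \sup\{|P(A\cap B)-P(A)P(B)|:A\in\sigma(\mathbf X_t,t\le s),\ B\in\sigma(\mathbf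 X_t,t\ge s+h)\}$$ be the strong mixing coefficients. Let $C\subset\overline{\mathbb R}{}^d$ be a Borel set which is bounded away from zero, i.e. $C\subset\{\mathbf x:|\mathbf x|>\epsilon\}$ for some $\epsilon>0$, and suppose that $\mu(\partial C)=0$ and $\mu_{h+1}(\partial(C\times\overline{\mathbb R}{}^{d(h-1)}\times C))=0$ for every $h\ge1$, where the boundaries are taken in $\overline{\mathbb R}{}_0^{d}$ and $\overline{\mathbb R}{}_0^{(h+1)d}$. Assume condition (M): $\alpha_h\to0$, and the integer sequences $m_n,r_n\to\infty$ satisfy $m_n/n\to0$, $r_n/m_n\to0$, $$\lim_{n\to\infty}m_n\sum_{h=r_n}^\infty\alpha_h=0,$$ and, for every $\epsilon>0$, $$\lim_{k\to\infty}\limsup_{n\to\infty}m_n\sum_{h=k}^{r_n}P(|\mathbf X_h|>\epsilon a_{m_n},|\mathbf X_0|>\epsilon a_{m_n})=0.$$ Put $k_n=n/m_n$ and assume that $k_n\alpha_{r_n}\to0$. Assume finally that either $m_n=o(n^{1/3})$, or $$\frac{m_n^4}{n}\sum_{j=r_n}^{m_n}\alpha_j\to0\quad\text{and}\quad\frac{m_nr_n^3}{n}\to0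 .$$ Then, for every $h\ge1$, the limit $c_h=\lim_{x\to\infty}P(|\mathbf Y_h|>x)/P(|\mathbf X_0|>x)$ exists in $(0,\infty)$; and with $\nu_h=c_h\mu_h$ (so that $\nu_1=\mu$), $\tau_h(C)=\nu_{h+1}(C\times\overline{\mathbb R}{}^{d(h-1)}\times C)$ and $$\sigma^2(C)=\mu(C)+2\sum_{h=1}^\infty\tau_h(C),$$ one has $\sigma^2(C)<\infty$ and $$\Big(\frac{m_n}{n}\Big)^{1/2}\sum_{t=1}^n\Big(I\{\mathbf X_t/a_{m_n}\in C\}-P(\mathbf X_0/a_{m_n}\in C)\Big)\xrightarrow{d}N(0,\sigma^2(C)),$$ where $N(0,0)$ is the point mass at $0$. -/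

import Mathlib

open MeasureTheory ProbabilityTheory Filter Topology
open scoped ENNReal NNReal CompactlySupported

namespace Extremogram

/-- The extended space `[-∞, ∞]^{hd}`, written as `h` blocks of length `d`. -/
abbrev Ext (h d : ℕ) : Type := Fin h → Fin d → EReal

/-- The punctured extended space `[-∞, ∞]^{hd} \ {0}`, with the subspace topology and the
Borel sigma-algebra. -/
abbrev Punctured (h d : ℕ) : Type := {y : Ext h d // y ≠ 0}

/-- The Euclidean norm on `[-∞, ∞]^d`; it is `∞` as soon as one coordinate is infinite. -/
noncomputable def extNorm {d : ℕ} (x : Fin d → EReal) : ℝ≥0∞ :=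
  (∑ i, (x i).abs ^ 2) ^ (1 / 2 : ℝ)

/-- `C ⊆ [-∞, ∞]^d` is bounded away from zero. -/
def BoundedAwayFromZero {d : ℕ} (C : Set (Fin d → EReal)) : Prop :=
  ∃ ε : ℝ, 0 < ε ∧ C ⊆ {x | ENNReal.ofReal ε < extNorm x}

/-- The vector `v / x` of `ℝ^d`, seen in `[-∞, ∞]^d`. -/
noncomputable def scaledPoint {d : ℕ} (x : ℝ) (v : EuclideanSpace ℝ (Fin d)) : Fin d → EReal :=
  fun j => ((v j / x : ℝ) : EReal)

section Series

variable {Ω : Type*} [MeasurableSpace Ω] {d : ℕ}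

/-- Strict stationarity: every time shift of the process has the same law (on the product space
`(ℝ^d)^ℤ`) as the process itself. -/
def StrictlyStationary (P : Measure Ω) (X : ℤ → Ω → EuclideanSpace ℝ (Fin d)) : Prop :=
  ∀ k : ℤ, IdentDistrib (fun ω (t : ℤ) => X (t + k) ω) (fun ω (t : ℤ) => X t ω) P P

/-- The Euclidean norm of the lagged vector `Y_h = vec(X_1, …, X_h)`. -/
noncomputable def lagNorm (X : ℤ → Ω → EuclideanSpace ℝ (Fin d)) (h : ℕ) (ω : Ω) : ℝ :=
  Real.sqrt (∑ i : Fin h, ‖X ((i : ℤ) + 1) ω‖ ^ 2)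

/-- The law of `x⁻¹ Y_h`, `Y_h = vec(X_1, …, X_h)`, restricted to `[-∞, ∞]^{hd} \ {0}`. -/
noncomputable def scaledLagLaw (P : Measure Ω) (X : ℤ → Ω → EuclideanSpace ℝ (Fin d))
    (h : ℕ) (x : ℝ) : Measure (Punctured h d) :=
  (P.map (fun ω (i : Fin h) => scaledPoint x (X ((i : ℤ) + 1) ω))).comap Subtype.val

/-- `(X_t)` is regularly varying with index `α > 0` and limiting measures `(μ_h)_{h ≥ 1}`:
for every `h ≥ 1`, `μ_h` is a non-null Radon measure on `[-∞, ∞]^{hd} \ {0}`, homogeneous of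
order `-α`, and `P(x⁻¹ Y_h ∈ ·) / P(|Y_h| > x)` converges vaguely to `μ_h` as `x → ∞`, that is,
the integrals of every compactly supported continuous function converge. -/
structure RegularlyVarying (P : Measure Ω) (X : ℤ → Ω → EuclideanSpace ℝ (Fin d)) (α : ℝ)
    (μ : (h : ℕ) → Measure (Punctured h d)) : Prop where
  index_pos : 0 < α
  radon : ∀ h, 1 ≤ h → IsFiniteMeasureOnCompacts (μ h)
  nonnull : ∀ h, 1 ≤ h → μ h ≠ 0
  homogeneous : ∀ h, 1 ≤ h → ∀ t : ℝ, 0 < t → ∀ B : Set (Ext h d), MeasurableSet B →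
    μ h (Subtype.val ⁻¹' ((fun y i j => (t : EReal) * y i j) '' B)) =
      ENNReal.ofReal (t ^ (-α)) * μ h (Subtype.val ⁻¹' B)
  vague : ∀ h, 1 ≤ h → ∀ f : C_c(Punctured h d, ℝ),
    Tendsto (fun x : ℝ => (∫ y, f y ∂(scaledLagLaw P X h x)) / P.real {ω | x < lagNorm X h ω})
      atTop (𝓝 (∫ y, f y ∂(μ h)))

/-- The strong (α-)mixing coefficient
`α_h = sup_s sup {|P(A ∩ B) - P(A) P(B)| : A ∈ σ(X_t, t ≤ s), B ∈ σ(X_t, t ≥ s + h)}`. -/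
noncomputable def alphaCoeff (P : Measure Ω) (X : ℤ → Ω → EuclideanSpace ℝ (Fin d))
    (h : ℕ) : ℝ :=
  sSup {x : ℝ | ∃ (s : ℤ) (A B : Set Ω),
    MeasurableSet[⨆ t ∈ Set.Iic s, MeasurableSpace.comap (X t) inferInstance] A ∧
    MeasurableSet[⨆ t ∈ Set.Ici (s + h), MeasurableSpace.comap (X t) inferInstance] B ∧
    x = |P.real (A ∩ B) - P.real A * P.real B|}

/-- The mixing and anti-clustering condition for the normalizing sequence `a` and the integer
sequences `m_n`, `r_n`: the process is α-mixing; `m_n, r_n → ∞`, `m_n / n → 0`, `r_n / m_n → 0`;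
`m_n ∑_{h ≥ r_n} α_h → 0` (the series being finite); and, for every `ε > 0`, the limit as `k → ∞`
of `limsup_n m_n ∑_{h=k}^{r_n} P(|X_h| > ε a_{m_n}, |X_0| > ε a_{m_n})` is zero. -/
structure ConditionM (P : Measure Ω) (X : ℤ → Ω → EuclideanSpace ℝ (Fin d)) (a : ℕ → ℝ)
    (m r : ℕ → ℕ) : Prop where
  mixing : Tendsto (alphaCoeff P X) atTop (𝓝 0)
  m_tendsto : Tendsto m atTop atTop
  r_tendsto : Tendsto r atTop atTop
  m_div_n : Tendsto (fun n : ℕ => (m n : ℝ) / n) atTop (𝓝 0)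
  r_div_m : Tendsto (fun n : ℕ => (r n : ℝ) / m n) atTop (𝓝 0)
  summable : Summable (alphaCoeff P X)
  tail_sum : Tendsto (fun n : ℕ => (m n : ℝ) * ∑' j : ℕ, alphaCoeff P X (r n + j)) atTop (𝓝 0)
  anticlustering : ∀ ε : ℝ, 0 < ε →
    Tendsto (fun k : ℕ => limsup (fun n : ℕ => (m n : ℝ≥0∞) * ∑ h ∈ Finset.Icc k (r n),
      P {ω | ε * a (m n) < ‖X h ω‖ ∧ ε * a (m n) < ‖X 0 ω‖}) atTop) atTop (𝓝 0)

/-- The normalized sum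
`S_n = (m_n / n)^{1/2} ∑_{t=1}^n (I{X_t / a_{m_n} ∈ C} - P(X_0 / a_{m_n} ∈ C))`. -/
noncomputable def normalizedSum (P : Measure Ω) (X : ℤ → Ω → EuclideanSpace ℝ (Fin d))
    (a : ℕ → ℝ) (m : ℕ → ℕ) (C : Set (Fin d → EReal)) (n : ℕ) (ω : Ω) : ℝ :=
  Real.sqrt ((m n : ℝ) / n) * ∑ t ∈ Finset.Icc 1 n,
    ({ω' | scaledPoint (a (m n)) (X (t : ℤ) ω') ∈ C}.indicator (fun _ => (1 : ℝ)) ω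
      - P.real {ω' | scaledPoint (a (m n)) (X 0 ω') ∈ C})

end Series

/-- The set `C` itself when `h = 0`, and `C × [-∞, ∞]^{d(h-1)} × C` when `h ≥ 1`, as a subset of
`[-∞, ∞]^{(h+1)d} \ {0}`. -/
def lagSet {d : ℕ} (C : Set (Fin d → EReal)) (h : ℕ) : Set (Punctured (h + 1) d) :=
  {y | y.1 0 ∈ C ∧ y.1 (Fin.last h) ∈ C}

/-- `τ_h(C) = ν_{h+1}(C × [-∞, ∞]^{d(h-1)} × C)`, where `ν_h = c_h μ_h`. -/
noncomputable def tau {d : ℕ} (c : ℕ → ℝ≥0) (μ : (h : ℕ) → Measure (Punctured h d))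
    (C : Set (Fin d → EReal)) (h : ℕ) : ℝ≥0∞ :=
  c (h + 1) * μ (h + 1) (lagSet C h)

/-- `σ²(C) = μ(C) + 2 ∑_{h ≥ 1} τ_h(C)`, with `μ = μ_1`. -/
noncomputable def sigmaSq {d : ℕ} (c : ℕ → ℝ≥0) (μ : (h : ℕ) → Measure (Punctured h d))
    (C : Set (Fin d → EReal)) : ℝ≥0∞ :=
  μ 1 (lagSet C 0) + 2 * ∑' h : ℕ, tau c μ C (h + 1)

end Extremogram

namespace Extremogram

/-! The proof is Bernstein's method of large and small blocks. Let `D n` be the set of v with v /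
a_{m_n} in C, p_n = P(X_0 ∈ D n), and Y_t the centred indicator of X_t ∈ D n. Regular variation
gives m_n P(X_0 ∈ D n, X_h ∈ D n) → τ_h(C) at each fixed lag. At lag 0 this makes p_n of order at
most 1/m_n, so m_n p_n² vanishes and m_n Cov(Y_0, Y_h) has the same limit. Lags between k and r_n
are controlled by anticlustering and lags beyond r_n by mixing, so the rescaled covariances have
uniformly small tails. This forces ∑ τ_h(C) < ∞ and lets the limit pass through the sum over lags: a
block of length m_n - r_n has variance tending to σ²(C).

Cut 1, …, n into windows of length m_n and drop the last r_n times of each, together with the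
incomplete window at the end. The dropped times form a vanishing proportion of n, and each adds
O(1/m_n) to the variance, so after multiplication by m_n / n their contribution tends to 0. The gaps
of length r_n let the characteristic function of the block sums be replaced by a power of that of a
single block, with an error of order (n / m_n) α_{r_n}.

It remains to expand one characteristic function to second order. The cubic remainder is
interpolated between second and fourth moments, so a Lyapunov condition (m_n / n) E S⁴ → 0 on the
block sum S suffices. The two growth alternatives serve only here: either the trivial bound |S| ≤
m_n is enough, or E S⁴ is expanded over ordered quadruples of times and estimated by mixing across a
long gap.

The main supports are `tendsto_measureReal_div_of_vague`, `RegularlyVarying.tendsto_joint`,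
`ConditionM.lagCov_tail`, `MixingBound.norm_cov_le`, `integral_pow_four_block_le` and
`norm_charFun_sub_pow_le`; `tendsto_charFun_array` assembles them. -/

/-! ### Portmanteau theorems for weak and vague convergence -/

theorem _root_.MeasureTheory.FiniteMeasure.tendsto_measure_of_null_frontier_of_tendsto
    {Ω ι : Type*} [MeasurableSpace Ω] [TopologicalSpace Ω] [OpensMeasurableSpace Ω]
    [HasOuterApproxClosed Ω] {L : Filter ι} {μs : ι → FiniteMeasure Ω} {μ : FiniteMeasure Ω}
    (h : Tendsto μs L (𝓝 μ)) {E : Set Ω} (hE : (μ : Measure Ω) (frontier E) = 0) :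
    Tendsto (fun i => μs i E) L (𝓝 (μ E)) := by
  rcases isEmpty_or_nonempty Ω with hΩ | hΩ
  · have : E = ∅ := Set.eq_empty_of_isEmpty E
    subst this
    have h0 : ∀ ρ : FiniteMeasure Ω, ρ ∅ = 0 := fun ρ => by simp [FiniteMeasure.coeFn_def]
    simp only [h0]
    exact tendsto_const_nhds
  have hmass : Tendsto (fun i => (μs i).mass) L (𝓝 μ.mass) := h.mass
  -- A zero limit cannot be normalised to a probability; there the total mass dominates.
  by_cases h0 : μ = 0
  · subst h0
    refine tendsto_of_tendsto_of_tendsto_of_le_of_le tendsto_const_nhds (by simpa using hmass)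
      (fun i => ?_) (fun i => (μs i).apply_le_mass E)
    simp
  have hn := FiniteMeasure.tendsto_normalize_of_tendsto h h0
  have hE' : (μ.normalize : Measure Ω) (frontier E) = 0 := by
    rw [μ.toMeasure_normalize_eq_of_nonzero h0]
    simp [hE]
  have := ProbabilityMeasure.tendsto_measure_of_null_frontier_of_tendsto hn
    (E := E) (by rw [ProbabilityMeasure.null_iff_toMeasure_null]; exact hE')
  have h2 := hmass.mul this
  simpa only [← FiniteMeasure.self_eq_mass_mul_normalize] using h2

/-- A compactly supported continuous g, equal to 1 on `K`, is used as a density. It makes the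
measures finite without changing the mass of subsets of `K`, and g f is an admissible test function
for every bounded continuous f. Vague convergence thus becomes weak convergence of finite measures.
-/
theorem tendsto_measureReal_div_of_vague {E ι : Type*} [TopologicalSpace E] [MeasurableSpace E]
    [BorelSpace E] [LocallyCompactSpace E] [TopologicalSpace.MetrizableSpace E] {L : Filter ι}
    {Q : ι → Measure E} [∀ i, IsFiniteMeasure (Q i)] {N : ι → ℝ} (hN : ∀ i, 0 ≤ N i)
    {μ : Measure E} [IsFiniteMeasureOnCompacts μ]
    (h : ∀ f : C_c(E, ℝ), Tendsto (fun i => (∫ y, f y ∂(Q i)) / N i) L (𝓝 (∫ y, f y ∂μ)))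
    {K B : Set E} (hK : IsCompact K) (hBK : B ⊆ K) (hB : MeasurableSet B)
    (hfr : μ (frontier B) = 0) :
    Tendsto (fun i => (Q i).real B / N i) L (𝓝 (μ.real B)) := by
  let _ := TopologicalSpace.metrizableSpaceMetric E
  obtain ⟨g, hg1, -, hgc, hg01⟩ := exists_continuous_one_zero_of_isCompact hK isClosed_empty
    (Set.disjoint_empty K)
  set w : E → ℝ≥0∞ := fun y => ENNReal.ofReal (g y) with hw
  have hwm : Measurable w := g.continuous.measurable.ennreal_ofReal
  have hwtop : ∀ y, w y < ∞ := fun y => ENNReal.ofReal_lt_top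
  have hwt : ∀ y, (w y).toReal = g y := fun y => ENNReal.toReal_ofReal (hg01 y).1
  have hint : ∀ (ρ : Measure E) (f : E → ℝ), ∫ y, f y ∂(ρ.withDensity w) = ∫ y, g y * f y ∂ρ := by
    intro ρ f
    rw [integral_withDensity_eq_integral_toReal_smul hwm (ae_of_all _ hwtop)]
    simp [hwt]
  have hset : ∀ ρ : Measure E, ρ.withDensity w B = ρ B := by
    intro ρ
    rw [withDensity_apply _ hB]
    calc ∫⁻ y in B, w y ∂ρ = ∫⁻ y in B, 1 ∂ρ := by
          refine setLIntegral_congr_fun hB fun y hy => ?_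
          simp [hw, hg1 (hBK hy)]
      _ = ρ B := by simp
  have hgint : Integrable g μ := g.continuous.integrable_of_hasCompactSupport hgc
  have : IsFiniteMeasure (μ.withDensity w) :=
    isFiniteMeasure_withDensity_ofReal hgint.2
  have hQf : ∀ i, IsFiniteMeasure ((Q i).withDensity w) := fun i =>
    isFiniteMeasure_withDensity_ofReal (Integrable.of_bound
      g.continuous.aestronglyMeasurable 1 (ae_of_all _ fun y => by
        rw [Real.norm_eq_abs, abs_of_nonneg (hg01 y).1]; exact (hg01 y).2)).2
  let ν : ι → FiniteMeasure E := fun i =>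
    (N i)⁻¹.toNNReal • (show FiniteMeasure E from ⟨(Q i).withDensity w, hQf i⟩)
  let ν₀ : FiniteMeasure E := ⟨μ.withDensity w, inferInstance⟩
  have hν : Tendsto ν L (𝓝 ν₀) := by
    refine FiniteMeasure.tendsto_of_forall_integral_tendsto fun f => ?_
    have hf := h ⟨⟨fun y => g y * f y, by fun_prop⟩, hgc.mul_right⟩
    change Tendsto _ L (𝓝 (∫ y, f y ∂(μ.withDensity w)))
    rw [hint]
    refine hf.congr fun i => ?_
    change _ = ∫ y, f y ∂((N i)⁻¹.toNNReal • (Q i).withDensity w)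
    rw [integral_smul_nnreal_measure, hint, NNReal.smul_def,
      Real.coe_toNNReal _ (inv_nonneg.2 (hN i)), div_eq_inv_mul]
    rfl
  have hfr' : (ν₀ : Measure E) (frontier B) = 0 :=
    withDensity_absolutelyContinuous μ w hfr
  have hfin := FiniteMeasure.tendsto_measure_of_null_frontier_of_tendsto hν hfr'
  have hfin' := (NNReal.continuous_coe.tendsto _).comp hfin
  have e0 : ((ν₀ B : ℝ≥0) : ℝ) = μ.real B := by
    change ((μ.withDensity w) B).toReal = _
    rw [hset]; rfl
  rw [e0] at hfin'
  refine hfin'.congr fun i => ?_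
  change (((N i)⁻¹.toNNReal • (show FiniteMeasure E from ⟨(Q i).withDensity w, hQf i⟩)) B : ℝ) = _
  rw [FiniteMeasure.smul_apply, smul_eq_mul, NNReal.coe_mul,
    Real.coe_toNNReal _ (inv_nonneg.2 (hN i)), div_eq_inv_mul]
  change _ * (((Q i).withDensity w) B).toReal = _
  rw [hset]
  rfl

/-! ### Topology of the punctured extended space -/

instance instSecondCountablePunctured (h d : ℕ) : SecondCountableTopology (Punctured h d) :=
  TopologicalSpace.Subtype.secondCountableTopology {y : Ext h d | y ≠ 0}

instance instMetrizablePunctured (h d : ℕ) : TopologicalSpace.MetrizableSpace (Punctured h d) :=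
  TopologicalSpace.metrizableSpace_of_t3_secondCountable _

instance instLocallyCompactPunctured (h d : ℕ) : LocallyCompactSpace (Punctured h d) :=
  (isOpen_compl_singleton (x := (0 : Ext h d))).isOpenEmbedding_subtypeVal.locallyCompactSpace

theorem continuous_ereal_abs : Continuous EReal.abs := by
  have : EReal.abs = fun x : EReal => max x.toENNReal (-x).toENNReal := by
    funext x
    induction x with
    | bot => simp
    | top => simp
    | coe x =>
      rw [EReal.abs_def, ← EReal.coe_neg, EReal.toENNReal_of_ne_top (by simp),
        EReal.toENNReal_of_ne_top (by simp), EReal.toReal_coe, EReal.toReal_coe,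
        ← ENNReal.ofReal_max, abs_eq_max_neg]
  rw [this]
  fun_prop

theorem continuous_extNorm {d : ℕ} : Continuous (extNorm : (Fin d → EReal) → ℝ≥0∞) := by
  unfold extNorm
  refine ENNReal.continuous_rpow_const.comp (continuous_finsetSum _ fun i _ => ?_)
  exact (ENNReal.continuous_pow 2).comp (continuous_ereal_abs.comp (continuous_apply i))

theorem extNorm_eq_zero {d : ℕ} {x : Fin d → EReal} : extNorm x = 0 ↔ x = 0 := by
  simp [extNorm, ENNReal.rpow_eq_zero_iff, funext_iff]

theorem extNorm_mul {d : ℕ} {t : ℝ} (ht : 0 < t) (x : Fin d → EReal) :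
    extNorm (fun j => (t : EReal) * x j) = ENNReal.ofReal t * extNorm x := by
  simp only [extNorm, EReal.abs_mul, mul_pow, ← Finset.mul_sum]
  rw [ENNReal.mul_rpow_of_nonneg _ _ (by norm_num), EReal.abs_def, abs_of_pos ht,
    ← ENNReal.rpow_natCast, ← ENNReal.rpow_mul]
  norm_num

theorem extNorm_scaledPoint {d : ℕ} {x : ℝ} (hx : 0 < x) (v : EuclideanSpace ℝ (Fin d)) :
    extNorm (scaledPoint x v) = ENNReal.ofReal (‖v‖ / x) := by
  have h1 : ∀ i, (scaledPoint x v i).abs ^ 2 = ENNReal.ofReal ((v i / x) ^ 2) := fun i => by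
    rw [scaledPoint, EReal.abs_def, ← ENNReal.ofReal_pow (abs_nonneg _), sq_abs]
  rw [extNorm, Finset.sum_congr rfl fun i _ => h1 i,
    ← ENNReal.ofReal_sum_of_nonneg fun i _ => sq_nonneg _,
    ENNReal.ofReal_rpow_of_nonneg (Finset.sum_nonneg fun i _ => sq_nonneg _) (by norm_num),
    EuclideanSpace.norm_eq]
  congr 1
  simp only [div_pow, ← Finset.sum_div, Real.norm_eq_abs, sq_abs]
  rw [← Real.sqrt_eq_rpow, Real.sqrt_div (Finset.sum_nonneg fun i _ => sq_nonneg _),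
    Real.sqrt_sq hx.le]

/-- `Ext h d` is compact and this closed set misses the origin, so puncturing does not affect its
compactness. A lower bound on one single block is enough. -/
theorem isCompact_le_extNorm {h d : ℕ} (i : Fin h) {ε : ℝ≥0∞} (hε : 0 < ε) :
    IsCompact {y : Punctured h d | ε ≤ extNorm (y.1 i)} := by
  have hcl : IsClosed {y : Ext h d | ε ≤ extNorm (y i)} :=
    isClosed_le continuous_const (continuous_extNorm.comp (continuous_apply i))
  refine Topology.IsInducing.subtypeVal.isCompact_preimage' hcl.isCompact ?_
  intro y hy
  refine ⟨⟨y, ?_⟩, rfl⟩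
  rintro rfl
  have : extNorm ((0 : Ext h d) i) = 0 := extNorm_eq_zero.2 rfl
  simp only [Set.mem_ofPred_eq, this] at hy
  exact absurd hy (not_le.2 hε)

theorem isOpen_lt_extNorm {h d : ℕ} (i : Fin h) (ε : ℝ≥0∞) :
    IsOpen {y : Punctured h d | ε < extNorm (y.1 i)} :=
  isOpen_lt continuous_const (continuous_extNorm.comp
    ((continuous_apply i).comp continuous_subtype_val))

theorem image_mul_lt_extNorm {h d : ℕ} (i : Fin h) {t : ℝ} (ht : 0 < t) :
    (fun (y : Ext h d) i j => (t : EReal) * y i j) '' {y | 1 < extNorm (y i)} =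
      {y | ENNReal.ofReal t < extNorm (y i)} := by
  have key : ∀ y : Ext h d, 1 < extNorm (y i) ↔
      ENNReal.ofReal t < extNorm (fun j => (t : EReal) * y i j) := fun y => by
    rw [extNorm_mul ht]
    nth_rewrite 1 [← mul_one (ENNReal.ofReal t)]
    exact (ENNReal.mul_lt_mul_iff_right (by simpa using ht) ENNReal.ofReal_ne_top).symm
  ext z
  constructor
  · rintro ⟨y, hy, rfl⟩
    exact (key y).1 hy
  · intro hz
    have hinv : ∀ w : EReal, (t : EReal) * ((t⁻¹ : ℝ) * w) = w := fun w => by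
      rw [← mul_assoc, ← EReal.coe_mul, mul_inv_cancel₀ ht.ne', EReal.coe_one, one_mul]
    refine ⟨fun i j => ((t⁻¹ : ℝ) : EReal) * z i j, ?_, by simp only [hinv]⟩
    have := (key fun i j => ((t⁻¹ : ℝ) : EReal) * z i j).2
    simp only [hinv] at this
    exact this hz

/-! ### Homogeneity of the limit measures -/

section RegVar

variable {Ω : Type*} [MeasurableSpace Ω] {P : Measure Ω} {d : ℕ}
  {X : ℤ → Ω → EuclideanSpace ℝ (Fin d)} {α : ℝ} {μ : (h : ℕ) → Measure (Punctured h d)}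

theorem RegularlyVarying.measure_lt_extNorm (hreg : RegularlyVarying P X α μ) {h : ℕ} (hh : 1 ≤ h)
    (i : Fin h) {t : ℝ} (ht : 0 < t) :
    μ h {y | ENNReal.ofReal t < extNorm (y.1 i)} =
      ENNReal.ofReal (t ^ (-α)) * μ h {y | 1 < extNorm (y.1 i)} := by
  have hm : MeasurableSet {y : Ext h d | 1 < extNorm (y i)} :=
    (isOpen_lt continuous_const (continuous_extNorm.comp (continuous_apply i))).measurableSet
  have := hreg.homogeneous h hh t ht _ hm
  rw [image_mul_lt_extNorm i ht] at this
  exact this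

theorem RegularlyVarying.measure_ne_top (hreg : RegularlyVarying P X α μ) {h : ℕ} (hh : 1 ≤ h)
    (i : Fin h) {ε : ℝ≥0∞} (hε : 0 < ε) {B : Set (Punctured h d)}
    (hB : B ⊆ {y | ε ≤ extNorm (y.1 i)}) : μ h B ≠ ∞ := by
  have := hreg.radon h hh
  exact ((measure_mono hB).trans_lt (isCompact_le_extNorm i hε).measure_lt_top).ne

/-- Homogeneity leaves no mass on the unit sphere of a block: for 0 < t < 1 the closure lies in the
level set at height t, whose mass is t^{-α} times that of `G` and tends to the finite mass of `G` as
t → 1. -/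
theorem RegularlyVarying.frontier_lt_extNorm (hreg : RegularlyVarying P X α μ) {h : ℕ}
    (hh : 1 ≤ h) (i : Fin h) : μ h (frontier {y | 1 < extNorm (y.1 i)}) = 0 := by
  set G : Set (Punctured h d) := {y | 1 < extNorm (y.1 i)} with hG
  have hfin : μ h G ≠ ∞ := hreg.measure_ne_top hh i one_pos fun y (hy : 1 < extNorm (y.1 i)) => hy.le
  have hsub : closure G ⊆ {y | 1 ≤ extNorm (y.1 i)} :=
    closure_minimal (fun y (hy : 1 < extNorm (y.1 i)) => hy.le) (isClosed_le continuous_const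
      (continuous_extNorm.comp ((continuous_apply i).comp continuous_subtype_val)))
  have hle : μ h (closure G) ≤ μ h G := by
    have hlim : Tendsto (fun t : ℝ => ENNReal.ofReal (t ^ (-α)) * μ h G) (𝓝[<] 1)
        (𝓝 (ENNReal.ofReal ((1 : ℝ) ^ (-α)) * μ h G)) := by
      refine ENNReal.Tendsto.mul_const ?_ (Or.inr hfin)
      refine ENNReal.tendsto_ofReal ?_
      exact ((Real.continuousAt_rpow_const 1 (-α) (Or.inl one_ne_zero)).tendsto).mono_left
        nhdsWithin_le_nhds
    rw [Real.one_rpow, ENNReal.ofReal_one, one_mul] at hlim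
    refine ge_of_tendsto hlim ?_
    filter_upwards [Ioo_mem_nhdsLT (zero_lt_one (α := ℝ))] with t ht
    rw [← hreg.measure_lt_extNorm hh i ht.1]
    refine measure_mono fun y hy => ?_
    have h1 : 1 ≤ extNorm (y.1 i) := hsub hy
    exact lt_of_lt_of_le (by simpa using ht.2) h1
  rw [frontier, (isOpen_lt_extNorm i 1).interior_eq,
    measure_sdiff subset_closure (isOpen_lt_extNorm i 1).nullMeasurableSet hfin]
  exact tsub_eq_zero_of_le hle

end RegVar

/-! ### Tail limits from regular variation and stationarity -/

section RegVarLimits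

variable {Ω : Type*} [MeasurableSpace Ω] {P : Measure Ω} {d : ℕ}
  {X : ℤ → Ω → EuclideanSpace ℝ (Fin d)} {α : ℝ} {μ : (h : ℕ) → Measure (Punctured h d)}

theorem StrictlyStationary.measureReal_eq (hstat : StrictlyStationary P X) (k : ℤ)
    {S : Set (ℤ → EuclideanSpace ℝ (Fin d))} (hS : MeasurableSet S) :
    P.real {ω | (fun t => X (t + k) ω) ∈ S} = P.real {ω | (fun t => X t ω) ∈ S} :=
  congrArg ENNReal.toReal ((hstat k).measure_mem_eq hS)

theorem StrictlyStationary.integral_eq {E : Type*} [NormedAddCommGroup E] [NormedSpace ℝ E]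
    [MeasurableSpace E] [BorelSpace E]
    (hstat : StrictlyStationary P X) (k : ℤ)
    {f : (ℤ → EuclideanSpace ℝ (Fin d)) → E} (hf : Measurable f) :
    ∫ ω, f (fun t => X (t + k) ω) ∂P = ∫ ω, f (fun t => X t ω) ∂P :=
  ((hstat k).comp hf).integral_eq

theorem StrictlyStationary.measureReal_norm (hstat : StrictlyStationary P X) (k : ℤ) (x : ℝ) :
    P.real {ω | x < ‖X k ω‖} = P.real {ω | x < ‖X 0 ω‖} := by
  have := hstat.measureReal_eq k (S := {f | x < ‖f 0‖})
    (measurableSet_lt measurable_const (by fun_prop))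
  simpa using this

theorem measurable_scaledPoint (x : ℝ) :
    Measurable (scaledPoint x : EuclideanSpace ℝ (Fin d) → Fin d → EReal) := by
  unfold scaledPoint
  fun_prop

theorem measurableEmbedding_punctured (h d : ℕ) :
    MeasurableEmbedding (Subtype.val : Punctured h d → Ext h d) :=
  MeasurableEmbedding.subtype_coe (measurableSet_singleton (0 : Ext h d)).compl

theorem scaledLagLaw_real (hX : ∀ t, Measurable (X t)) {h : ℕ} (x : ℝ) {S : Set (Ext h d)}
    (hS : MeasurableSet S) (h0 : (0 : Ext h d) ∉ S) :
    (scaledLagLaw P X h x).real (Subtype.val ⁻¹' S) =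
      P.real {ω | (fun i : Fin h => scaledPoint x (X ((i : ℤ) + 1) ω)) ∈ S} := by
  have hY : Measurable fun ω (i : Fin h) => scaledPoint x (X ((i : ℤ) + 1) ω) :=
    measurable_pi_lambda _ fun i => (measurable_scaledPoint x).comp (hX _)
  rw [measureReal_def, measureReal_def, scaledLagLaw,
    (measurableEmbedding_punctured h d).comap_apply, Set.image_preimage_eq_of_subset, Measure.map_apply hY hS]
  · rfl
  · intro y hy
    exact ⟨⟨y, by rintro rfl; exact h0 hy⟩, rfl⟩

theorem RegularlyVarying.tendsto_event [IsProbabilityMeasure P] (hX : ∀ t, Measurable (X t))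
    (hreg : RegularlyVarying P X α μ) {h : ℕ} (hh : 1 ≤ h) (i : Fin h) {ε : ℝ≥0∞} (hε : 0 < ε)
    {S : Set (Ext h d)} (hS : MeasurableSet S) (hSε : S ⊆ {y | ε ≤ extNorm (y i)})
    (hfr : μ h (frontier (Subtype.val ⁻¹' S)) = 0) :
    Tendsto (fun x : ℝ => P.real {ω | (fun i : Fin h => scaledPoint x (X ((i : ℤ) + 1) ω)) ∈ S} /
      P.real {ω | x < lagNorm X h ω}) atTop (𝓝 ((μ h).real (Subtype.val ⁻¹' S))) := by
  have h0 : (0 : Ext h d) ∉ S := fun hmem => by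
    have h1 : ε ≤ extNorm ((0 : Ext h d) i) := hSε hmem
    rw [show (0 : Ext h d) i = 0 from rfl, extNorm_eq_zero.2 rfl] at h1
    exact absurd hε (not_lt.2 h1)
  have hfinQ : ∀ x, IsFiniteMeasure (scaledLagLaw P X h x) := fun x => by
    unfold scaledLagLaw
    refine ⟨?_⟩
    rw [(measurableEmbedding_punctured h d).comap_apply]
    exact measure_lt_top _ _
  have := hreg.radon h hh
  have key := tendsto_measureReal_div_of_vague (fun x => measureReal_nonneg)
    (hreg.vague h hh) (isCompact_le_extNorm i hε) (B := Subtype.val ⁻¹' S) (fun y hy => hSε hy)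
    (measurable_subtype_coe hS) hfr
  simpa only [scaledLagLaw_real hX _ hS h0] using key

/-- By stationarity every block has the tail of X_0, so the left side does not involve `i`; the
limit is therefore the same for all blocks. -/
theorem RegularlyVarying.tendsto_norm [IsProbabilityMeasure P] (hX : ∀ t, Measurable (X t))
    (hstat : StrictlyStationary P X)
    (hreg : RegularlyVarying P X α μ) {h : ℕ} (hh : 1 ≤ h) (i : Fin h) :
    Tendsto (fun x : ℝ => P.real {ω | x < ‖X 0 ω‖} / P.real {ω | x < lagNorm X h ω}) atTop
      (𝓝 ((μ h).real {y | 1 < extNorm (y.1 i)})) := by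
  have hS : MeasurableSet {y : Ext h d | 1 < extNorm (y i)} :=
    (isOpen_lt continuous_const (continuous_extNorm.comp (continuous_apply i))).measurableSet
  have key := hreg.tendsto_event hX hh i one_pos hS
    (fun y (hy : 1 < extNorm (y i)) => hy.le) (hreg.frontier_lt_extNorm hh i)
  refine key.congr' ?_
  filter_upwards [eventually_gt_atTop 0] with x hx
  rw [← hstat.measureReal_norm ((i : ℤ) + 1) x]
  congr 2
  ext ω
  change 1 < extNorm (scaledPoint x (X ((i : ℤ) + 1) ω)) ↔ _
  rw [extNorm_scaledPoint hx, ENNReal.one_lt_ofReal, one_lt_div hx]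
  rfl

/-- The inverse ratio has a limit `q` that is common to all blocks. If `q` were 0, homogeneity would
annul every level set of every block norm; these cover the punctured space, so `μ h` would be null.
The constant is 1/q. -/
theorem RegularlyVarying.exists_pos [IsProbabilityMeasure P] (hX : ∀ t, Measurable (X t))
    (hstat : StrictlyStationary P X)
    (hreg : RegularlyVarying P X α μ) {h : ℕ} (hh : 1 ≤ h) :
    ∃ c : ℝ≥0, 0 < c ∧
      Tendsto (fun x : ℝ => P.real {ω | x < lagNorm X h ω} / P.real {ω | x < ‖X 0 ω‖})
        atTop (𝓝 (c : ℝ)) := by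
  set i₀ : Fin h := ⟨0, hh⟩
  set q : ℝ := (μ h).real {y | 1 < extNorm (y.1 i₀)} with hq
  have hlim : ∀ i, Tendsto (fun x : ℝ => P.real {ω | x < ‖X 0 ω‖} /
      P.real {ω | x < lagNorm X h ω}) atTop (𝓝 ((μ h).real {y | 1 < extNorm (y.1 i)})) :=
    hreg.tendsto_norm hX hstat hh
  have hqi : ∀ i, (μ h).real {y | 1 < extNorm (y.1 i)} = q := fun i =>
    tendsto_nhds_unique (hlim i) (hlim i₀)
  have hq0 : 0 < q := by
    refine lt_of_le_of_ne measureReal_nonneg fun h0 => hreg.nonnull h hh ?_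
    have hz : ∀ i, μ h {y | 1 < extNorm (y.1 i)} = 0 := fun i => by
      have hfin : μ h {y : Punctured h d | 1 < extNorm (y.1 i)} ≠ ∞ :=
        hreg.measure_ne_top hh i one_pos fun y (hy : 1 < extNorm (y.1 i)) => hy.le
      have := hqi i
      rw [← h0, measureReal_def, ENNReal.toReal_eq_zero_iff] at this
      exact this.resolve_right hfin
    have hz' : ∀ (i : Fin h) (n : ℕ),
        μ h {y | ENNReal.ofReal (1 / ((n : ℝ) + 1)) < extNorm (y.1 i)} = 0 := fun i n => by
      rw [hreg.measure_lt_extNorm hh i (by positivity), hz i, mul_zero]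
    refine Measure.measure_univ_eq_zero.1 (measure_mono_null ?_
      (measure_iUnion_null fun i => measure_iUnion_null fun n => hz' i n))
    rintro ⟨y, hy⟩ -
    obtain ⟨i, hi⟩ : ∃ i, y i ≠ 0 := by
      by_contra hcon
      push Not at hcon
      exact hy (funext hcon)
    have hpos : 0 < extNorm (y i) := pos_iff_ne_zero.2 fun h => hi (extNorm_eq_zero.1 h)
    have ht : Tendsto (fun n : ℕ => ENNReal.ofReal (1 / ((n : ℝ) + 1))) atTop (𝓝 0) := by
      simpa using ENNReal.tendsto_ofReal (tendsto_one_div_add_atTop_nhds_zero_nat (𝕜 := ℝ))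
    obtain ⟨n, hn⟩ := (ht.eventually_lt_const hpos).exists
    exact Set.mem_iUnion.2 ⟨i, Set.mem_iUnion.2 ⟨n, hn⟩⟩
  refine ⟨⟨q⁻¹, (inv_pos.2 hq0).le⟩, NNReal.coe_pos.1 (inv_pos.2 hq0), ?_⟩
  have := (hlim i₀).inv₀ hq0.ne'
  simp only [inv_div] at this
  exact this

omit [MeasurableSpace Ω] in
theorem lagNorm_one (ω : Ω) : lagNorm X 1 ω = ‖X 1 ω‖ := by
  simp [lagNorm]

theorem RegularlyVarying.tail_pos [IsProbabilityMeasure P] (hX : ∀ t, Measurable (X t))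
    (hstat : StrictlyStationary P X) (hreg : RegularlyVarying P X α μ) (x : ℝ) :
    0 < P.real {ω | x < ‖X 0 ω‖} := by
  obtain ⟨c, hc, hlim⟩ := hreg.exists_pos hX hstat le_rfl
  obtain ⟨y, hy, hxy⟩ := ((hlim.eventually_const_lt (NNReal.coe_pos.2 hc)).and
    (eventually_ge_atTop x)).exists
  refine lt_of_lt_of_le (b := P.real {ω | y < ‖X 0 ω‖}) ?_
    (measureReal_mono fun ω (hω : y < ‖X 0 ω‖) => hxy.trans_lt hω)
  refine lt_of_le_of_ne measureReal_nonneg fun h0 => ?_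
  -- With division by zero equal to zero, a vanishing tail at `y` contradicts the positivity of the
  -- ratio there.
  rw [← h0, div_zero] at hy
  exact lt_irrefl _ hy

theorem RegularlyVarying.const_one [IsProbabilityMeasure P] (hX : ∀ t, Measurable (X t))
    (hstat : StrictlyStationary P X) (hreg : RegularlyVarying P X α μ) {c : ℝ}
    (hc : Tendsto (fun x : ℝ => P.real {ω | x < lagNorm X 1 ω} / P.real {ω | x < ‖X 0 ω‖})
        atTop (𝓝 c)) : c = 1 := by
  refine tendsto_nhds_unique hc (tendsto_const_nhds.congr fun x => ?_)
  simp only [lagNorm_one]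
  rw [hstat.measureReal_norm 1 x, div_self (hreg.tail_pos hX hstat x).ne']

theorem RegularlyVarying.threshold_tendsto_atTop [IsProbabilityMeasure P] (hX : ∀ t, Measurable (X t))
    (hstat : StrictlyStationary P X) (hreg : RegularlyVarying P X α μ) {a : ℕ → ℝ}
    (ha : Tendsto (fun n : ℕ => (n : ℝ) * P.real {ω | a n < ‖X 0 ω‖}) atTop (𝓝 1)) :
    Tendsto a atTop atTop := by
  have h0 : Tendsto (fun n : ℕ => P.real {ω | a n < ‖X 0 ω‖}) atTop (𝓝 0) := by
    have h1 := ha.mul (tendsto_inv_atTop_nhds_zero_nat (𝕜 := ℝ))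
    rw [mul_zero] at h1
    refine h1.congr' ?_
    filter_upwards [eventually_ne_atTop 0] with n hn
    have : (n : ℝ) ≠ 0 := by exact_mod_cast hn
    field_simp
  refine tendsto_atTop.2 fun x => ?_
  filter_upwards [h0.eventually_lt_const (hreg.tail_pos hX hstat x)] with n hn
  by_contra hcon
  exact absurd hn (not_lt.2 (measureReal_mono fun ω (hω : x < ‖X 0 ω‖) => (not_le.1 hcon).trans hω))

/-- Joint exceedances at lag `h` of the set `C`, rescaled, converge to `τ_h(C)`. -/
theorem RegularlyVarying.tendsto_joint [IsProbabilityMeasure P] (hX : ∀ t, Measurable (X t))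
    (hstat : StrictlyStationary P X) (hreg : RegularlyVarying P X α μ) {a : ℕ → ℝ}
    (ha : Tendsto (fun n : ℕ => (n : ℝ) * P.real {ω | a n < ‖X 0 ω‖}) atTop (𝓝 1))
    {C : Set (Fin d → EReal)} (hC : MeasurableSet C) (hC0 : BoundedAwayFromZero C)
    {m : ℕ → ℕ} (hm : Tendsto m atTop atTop) {h : ℕ}
    (hfr : μ (h + 1) (frontier (lagSet C h)) = 0) {c : ℝ≥0}
    (hc : Tendsto (fun x : ℝ => P.real {ω | x < lagNorm X (h + 1) ω} / P.real {ω | x < ‖X 0 ω‖})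
        atTop (𝓝 c)) :
    Tendsto (fun n => (m n : ℝ) * P.real {ω | scaledPoint (a (m n)) (X 0 ω) ∈ C ∧
      scaledPoint (a (m n)) (X h ω) ∈ C}) atTop (𝓝 (c * μ (h + 1) (lagSet C h)).toReal) ∧
      μ (h + 1) (lagSet C h) ≠ ∞ := by
  obtain ⟨ε, hε, hCε⟩ := hC0
  have hS : MeasurableSet {y : Ext (h + 1) d | y 0 ∈ C ∧ y (Fin.last h) ∈ C} :=
    (measurable_pi_apply 0 hC).inter (measurable_pi_apply (Fin.last h) hC)
  have hSε : {y : Ext (h + 1) d | y 0 ∈ C ∧ y (Fin.last h) ∈ C} ⊆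
      {y | ENNReal.ofReal ε ≤ extNorm (y 0)} := fun y hy => by
    have h1 : ENNReal.ofReal ε < extNorm (y 0) := hCε hy.1
    exact h1.le
  refine ⟨?_, hreg.measure_ne_top (by omega) 0 (ENNReal.ofReal_pos.2 hε)
    (fun y (hy : y.1 ∈ _) => hSε hy)⟩
  have h1 := hreg.tendsto_event hX (by omega) 0 (ENNReal.ofReal_pos.2 hε) hS hSε hfr
  have h2 := (((hreg.threshold_tendsto_atTop hX hstat ha).comp hm))
  -- The three ratios telescope: m P(|X_0| > a_m), the tail of |Y_{h+1}| over that of |X_0|, and the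
  -- joint event over the tail of |Y_{h+1}|.
  have h3 := ((ha.comp hm).mul (hc.comp h2)).mul (h1.comp h2)
  have e1 : (c * μ (h + 1) (lagSet C h)).toReal =
      1 * c * (μ (h + 1)).real (Subtype.val ⁻¹'
        {y : Ext (h + 1) d | y 0 ∈ C ∧ y (Fin.last h) ∈ C}) := by
    rw [ENNReal.toReal_mul, one_mul]
    rfl
  rw [e1]
  have hlagpos : ∀ᶠ x in atTop, 0 < P.real {ω | x < lagNorm X (h + 1) ω} := by
    obtain ⟨c', hc', hl⟩ := hreg.exists_pos hX hstat (h := h + 1) (by omega)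
    filter_upwards [hl.eventually_const_lt (NNReal.coe_pos.2 hc')] with x hx
    refine lt_of_le_of_ne measureReal_nonneg fun h0 => ?_
    rw [← h0, zero_div] at hx
    exact lt_irrefl _ hx
  refine h3.congr' ?_
  filter_upwards [h2.eventually hlagpos] with n hn
  have hn0 := (hreg.tail_pos hX hstat (a (m n))).ne'
  -- The lagged vector starts at time 1, the joint event at time 0; stationarity shifts one to the
  -- other.
  have e2 : P.real {ω | scaledPoint (a (m n)) (X 0 ω) ∈ C ∧ scaledPoint (a (m n)) (X h ω) ∈ C} =
      P.real {ω | (fun i : Fin (h + 1) => scaledPoint (a (m n)) (X ((i : ℤ) + 1) ω)) ∈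
        {y : Ext (h + 1) d | y 0 ∈ C ∧ y (Fin.last h) ∈ C}} := by
    have := hstat.measureReal_eq 1
      (S := {f | scaledPoint (a (m n)) (f 0) ∈ C ∧ scaledPoint (a (m n)) (f h) ∈ C})
      ((((measurable_scaledPoint _).comp (measurable_pi_apply 0)) hC).inter
        (((measurable_scaledPoint _).comp (measurable_pi_apply (h : ℤ))) hC))
    simpa using this.symm
  rw [e2]
  simp only [Function.comp_apply] at hn ⊢
  field_simp
  rfl

end RegVarLimits

/-! ### Covariance inequalities under mixing -/

section CovarianceInequality

variable {Ω : Type*} {m₁ m₂ mΩ : MeasurableSpace Ω} {P : Measure Ω} [IsProbabilityMeasure P]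

theorem integrable_of_abs_le {f : Ω → ℝ} (hf : Measurable f) {b : ℝ} (hb : ∀ ω, |f ω| ≤ b) :
    Integrable f P :=
  Integrable.of_bound hf.aestronglyMeasurable b (ae_of_all _ hb)

/-- Conditioning on `m₁` turns the integral into that of f E[w | m₁]; among f with values in [0, 1]
it is largest for the indicator of the set where E[w | m₁] ≥ 0. -/
theorem integral_mul_le_of_setIntegral_le (h₁ : m₁ ≤ mΩ) {f w : Ω → ℝ} {a : ℝ}
    (hf : Measurable[m₁] f) (hf0 : ∀ ω, 0 ≤ f ω) (hf1 : ∀ ω, f ω ≤ 1) (hw : Integrable w P)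
    (hA : ∀ A, MeasurableSet[m₁] A → ∫ ω in A, w ω ∂P ≤ a) :
    ∫ ω, f ω * w ω ∂P ≤ a := by
  have hfm : AEStronglyMeasurable f P := (hf.mono h₁ le_rfl).aestronglyMeasurable
  have hfb : ∀ᵐ ω ∂P, ‖f ω‖ ≤ 1 := ae_of_all _ fun ω => by
    rw [Real.norm_eq_abs, abs_of_nonneg (hf0 ω)]; exact hf1 ω
  have hfw : Integrable (f * w) P := hw.bdd_mul hfm hfb
  have hAm : MeasurableSet[m₁] {ω | 0 ≤ (P[w | m₁]) ω} :=
    stronglyMeasurable_condExp.measurable measurableSet_Ici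
  calc ∫ ω, f ω * w ω ∂P = ∫ ω, (P[f * w | m₁]) ω ∂P := (integral_condExp h₁).symm
    _ = ∫ ω, f ω * (P[w | m₁]) ω ∂P :=
        integral_congr_ae (condExp_mul_of_stronglyMeasurable_left hf.stronglyMeasurable hfw hw)
    _ ≤ ∫ ω, {ω | 0 ≤ (P[w | m₁]) ω}.indicator (P[w | m₁]) ω ∂P := by
        refine integral_mono (integrable_condExp.bdd_mul hfm hfb)
          (integrable_condExp.indicator (h₁ _ hAm)) fun ω => ?_
        by_cases h : 0 ≤ (P[w | m₁]) ω
        · rw [Set.indicator_of_mem (show ω ∈ {ω | 0 ≤ (P[w | m₁]) ω} from h)]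
          exact mul_le_of_le_one_left h (hf1 ω)
        · rw [Set.indicator_of_notMem (show ω ∉ {ω | 0 ≤ (P[w | m₁]) ω} from h)]
          exact mul_nonpos_of_nonneg_of_nonpos (hf0 ω) (not_le.1 h).le
    _ = ∫ ω in {ω | 0 ≤ (P[w | m₁]) ω}, w ω ∂P := by
        rw [integral_indicator (h₁ _ hAm), setIntegral_condExp h₁ hw hAm]
    _ ≤ a := hA _ hAm

theorem abs_integral_mul_le_of_setIntegral_le (h₁ : m₁ ≤ mΩ) {f w : Ω → ℝ} {a : ℝ}
    (hf : Measurable[m₁] f) (hf0 : ∀ ω, 0 ≤ f ω) (hf1 : ∀ ω, f ω ≤ 1) (hw : Integrable w P)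
    (hA : ∀ A, MeasurableSet[m₁] A → |∫ ω in A, w ω ∂P| ≤ a) :
    |∫ ω, f ω * w ω ∂P| ≤ a := by
  refine abs_le'.2 ⟨integral_mul_le_of_setIntegral_le h₁ hf hf0 hf1 hw
    fun A hAm => (abs_le'.1 (hA A hAm)).1, ?_⟩
  have := integral_mul_le_of_setIntegral_le (P := P) h₁ hf hf0 hf1 hw.neg (a := a)
    fun A hAm => by
      simp only [Pi.neg_apply, integral_neg]
      exact (abs_le'.1 (hA A hAm)).2
  simpa only [Pi.neg_apply, mul_neg, integral_neg] using this

/-- `a` bounds the dependence between the sigma-algebras `m₁` and `m₂`. -/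
def MixingBound (m₁ m₂ : MeasurableSpace Ω) {mΩ : MeasurableSpace Ω} (P : Measure Ω) (a : ℝ) :
    Prop :=
  ∀ A B, MeasurableSet[m₁] A → MeasurableSet[m₂] B →
    |P.real (A ∩ B) - P.real A * P.real B| ≤ a

/-- Events are replaced by functions one at a time: first `f` replaces A with B fixed (`hset`), then
`g` replaces B. -/
theorem MixingBound.abs_cov_le (h₁ : m₁ ≤ mΩ) (h₂ : m₂ ≤ mΩ) {a : ℝ}
    (hmix : MixingBound m₁ m₂ P a) {f g : Ω → ℝ}
    (hf : Measurable[m₁] f) (hf0 : ∀ ω, 0 ≤ f ω) (hf1 : ∀ ω, f ω ≤ 1)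
    (hg : Measurable[m₂] g) (hg0 : ∀ ω, 0 ≤ g ω) (hg1 : ∀ ω, g ω ≤ 1) :
    |∫ ω, f ω * g ω ∂P - (∫ ω, f ω ∂P) * ∫ ω, g ω ∂P| ≤ a := by
  have hfm := hf.mono h₁ le_rfl
  have hgm := hg.mono h₂ le_rfl
  have hfi : Integrable f P := integrable_of_abs_le hfm (b := 1) fun ω => by
    rw [abs_of_nonneg (hf0 ω)]; exact hf1 ω
  have hgi : Integrable g P := integrable_of_abs_le hgm (b := 1) fun ω => by
    rw [abs_of_nonneg (hg0 ω)]; exact hg1 ω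
  have hfgi : Integrable (fun ω => f ω * g ω) P :=
    integrable_of_abs_le (hfm.mul hgm) (b := 1) fun ω => by
      rw [abs_of_nonneg (mul_nonneg (hf0 ω) (hg0 ω))]
      exact mul_le_one₀ (hf1 ω) (hg0 ω) (hg1 ω)
  have hset : ∀ B, MeasurableSet[m₂] B → |∫ ω in B, (f ω - ∫ ω, f ω ∂P) ∂P| ≤ a := by
    intro B hB
    have hB' := h₂ B hB
    have hind : Integrable (B.indicator (fun _ => (1 : ℝ))) P :=
      (integrable_const 1).indicator hB'
    have := abs_integral_mul_le_of_setIntegral_le (P := P) h₁ hf hf0 hf1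
      (w := fun ω => B.indicator (fun _ => (1 : ℝ)) ω - P.real B) (a := a)
      (hind.sub (integrable_const _)) (fun A hA => by
        have hA' := h₁ A hA
        rw [integral_sub hind.integrableOn (integrable_const _).integrableOn,
          setIntegral_indicator hB']
        simpa [mul_comm] using hmix A B hA hB)
    convert this using 2
    rw [integral_sub hfi.integrableOn (integrable_const _).integrableOn]
    simp only [mul_sub]
    rw [integral_sub _ (hfi.mul_const _), integral_mul_const]
    · have e : ∀ ω, f ω * B.indicator (fun _ => (1 : ℝ)) ω = B.indicator f ω := fun ω => by
        by_cases h : ω ∈ B <;> simp [h]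
      simp only [e, integral_indicator hB']
      simp [mul_comm]
    · exact hfi.mul_bdd (c := 1) hind.aestronglyMeasurable (ae_of_all _ fun ω => by
        by_cases h : ω ∈ B <;> simp [h])
  have := abs_integral_mul_le_of_setIntegral_le (P := P) h₂ hg hg0 hg1
    (w := fun ω => f ω - ∫ ω, f ω ∂P) (hfi.sub (integrable_const _)) hset
  convert this using 2
  simp only [mul_sub]
  rw [integral_sub (by simpa only [mul_comm] using hfgi) (hgi.mul_const _), integral_mul_const]
  simp only [mul_comm]

/-- The maps (f + 1)/2 and (g + 1)/2 take values in [0, 1] and have a quarter of the covariance. -/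
theorem MixingBound.abs_cov_le_four (h₁ : m₁ ≤ mΩ) (h₂ : m₂ ≤ mΩ) {a : ℝ}
    (hmix : MixingBound m₁ m₂ P a) {f g : Ω → ℝ}
    (hf : Measurable[m₁] f) (hf1 : ∀ ω, |f ω| ≤ 1)
    (hg : Measurable[m₂] g) (hg1 : ∀ ω, |g ω| ≤ 1) :
    |∫ ω, f ω * g ω ∂P - (∫ ω, f ω ∂P) * ∫ ω, g ω ∂P| ≤ 4 * a := by
  have hfm := hf.mono h₁ le_rfl
  have hgm := hg.mono h₂ le_rfl
  have hfi : Integrable f P := integrable_of_abs_le hfm hf1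
  have hgi : Integrable g P := integrable_of_abs_le hgm hg1
  have hfgi : Integrable (fun ω => f ω * g ω) P :=
    integrable_of_abs_le (hfm.mul hgm) (b := 1) fun ω => by
      rw [abs_mul]
      exact mul_le_one₀ (hf1 ω) (abs_nonneg _) (hg1 ω)
  have key := hmix.abs_cov_le h₁ h₂ (f := fun ω => (f ω + 1) / 2) (g := fun ω => (g ω + 1) / 2)
    ((hf.add_const 1).div_const 2) (fun ω => by linarith [(abs_le.1 (hf1 ω)).1])
    (fun ω => by linarith [(abs_le.1 (hf1 ω)).2])
    ((hg.add_const 1).div_const 2) (fun ω => by linarith [(abs_le.1 (hg1 ω)).1])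
    (fun ω => by linarith [(abs_le.1 (hg1 ω)).2])
  have e1 : ∫ ω, (f ω + 1) / 2 ∂P = (∫ ω, f ω ∂P + 1) / 2 := by
    rw [integral_div, integral_add hfi (integrable_const _)]; simp
  have e2 : ∫ ω, (g ω + 1) / 2 ∂P = (∫ ω, g ω ∂P + 1) / 2 := by
    rw [integral_div, integral_add hgi (integrable_const _)]; simp
  have e3 : ∫ ω, (f ω + 1) / 2 * ((g ω + 1) / 2) ∂P =
      (∫ ω, f ω * g ω ∂P + ∫ ω, f ω ∂P + ∫ ω, g ω ∂P + 1) / 4 := by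
    have : ∀ ω, (f ω + 1) / 2 * ((g ω + 1) / 2) = (f ω * g ω + f ω + g ω + 1) / 4 := fun ω => by
      ring
    simp only [this]
    have i1 : Integrable (fun ω => f ω * g ω + f ω) P := hfgi.add hfi
    have i2 : Integrable (fun ω => f ω * g ω + f ω + g ω) P := i1.add hgi
    rw [integral_div, integral_add i2 (integrable_const _), integral_add i1 hgi,
      integral_add hfgi hfi]
    simp
  rw [e1, e2, e3] at key
  have e4 : (∫ ω, f ω * g ω ∂P + ∫ ω, f ω ∂P + ∫ ω, g ω ∂P + 1) / 4 -
      (∫ ω, f ω ∂P + 1) / 2 * ((∫ ω, g ω ∂P + 1) / 2) =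
      (∫ ω, f ω * g ω ∂P - (∫ ω, f ω ∂P) * ∫ ω, g ω ∂P) / 4 := by ring
  rw [e4, abs_div, abs_of_pos (by norm_num : (0 : ℝ) < 4)] at key
  linarith

/-- Real and imaginary parts produce four real covariances, each at most 4a. -/
theorem MixingBound.norm_cov_le (h₁ : m₁ ≤ mΩ) (h₂ : m₂ ≤ mΩ) {a : ℝ}
    (hmix : MixingBound m₁ m₂ P a) {f g : Ω → ℂ}
    (hf : Measurable[m₁] f) (hf1 : ∀ ω, ‖f ω‖ ≤ 1)
    (hg : Measurable[m₂] g) (hg1 : ∀ ω, ‖g ω‖ ≤ 1) :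
    ‖∫ ω, f ω * g ω ∂P - (∫ ω, f ω ∂P) * ∫ ω, g ω ∂P‖ ≤ 16 * a := by
  have hfm := hf.mono h₁ le_rfl
  have hgm := hg.mono h₂ le_rfl
  have hfi : Integrable f P := Integrable.of_bound hfm.aestronglyMeasurable 1 (ae_of_all _ hf1)
  have hgi : Integrable g P := Integrable.of_bound hgm.aestronglyMeasurable 1 (ae_of_all _ hg1)
  have hfgi : Integrable (fun ω => f ω * g ω) P :=
    Integrable.of_bound (hfm.mul hgm).aestronglyMeasurable 1 (ae_of_all _ fun ω => by
      rw [norm_mul]; exact mul_le_one₀ (hf1 ω) (norm_nonneg _) (hg1 ω))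
  have hfr : Measurable[m₁] fun ω => (f ω).re := Complex.measurable_re.comp hf
  have hfim : Measurable[m₁] fun ω => (f ω).im := Complex.measurable_im.comp hf
  have hgr : Measurable[m₂] fun ω => (g ω).re := Complex.measurable_re.comp hg
  have hgim : Measurable[m₂] fun ω => (g ω).im := Complex.measurable_im.comp hg
  have bfr : ∀ ω, |(f ω).re| ≤ 1 := fun ω => (Complex.abs_re_le_norm _).trans (hf1 ω)
  have bfi : ∀ ω, |(f ω).im| ≤ 1 := fun ω => (Complex.abs_im_le_norm _).trans (hf1 ω)
  have bgr : ∀ ω, |(g ω).re| ≤ 1 := fun ω => (Complex.abs_re_le_norm _).trans (hg1 ω)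
  have bgi : ∀ ω, |(g ω).im| ≤ 1 := fun ω => (Complex.abs_im_le_norm _).trans (hg1 ω)
  have hmul : ∀ {u v : Ω → ℝ}, Measurable[mΩ] u → Measurable[mΩ] v → (∀ ω, |u ω| ≤ 1) →
      (∀ ω, |v ω| ≤ 1) → Integrable (fun ω => u ω * v ω) P := fun hu hv bu bv =>
    integrable_of_abs_le (hu.mul hv) (b := 1) fun ω => by
      rw [abs_mul]
      exact mul_le_one₀ (bu ω) (abs_nonneg _) (bv ω)
  have re_int : ∀ {u : Ω → ℂ}, Integrable u P → (∫ ω, u ω ∂P).re = ∫ ω, (u ω).re ∂P :=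
    fun hu => (integral_re hu).symm
  have im_int : ∀ {u : Ω → ℂ}, Integrable u P → (∫ ω, u ω ∂P).im = ∫ ω, (u ω).im ∂P :=
    fun hu => (integral_im hu).symm
  have k1 := hmix.abs_cov_le_four h₁ h₂ hfr bfr hgr bgr
  have k2 := hmix.abs_cov_le_four h₁ h₂ hfim bfi hgim bgi
  have k3 := hmix.abs_cov_le_four h₁ h₂ hfr bfr hgim bgi
  have k4 := hmix.abs_cov_le_four h₁ h₂ hfim bfi hgr bgr
  refine (Complex.norm_le_abs_re_add_abs_im _).trans ?_
  have hre : (∫ ω, f ω * g ω ∂P - (∫ ω, f ω ∂P) * ∫ ω, g ω ∂P).re =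
      (∫ ω, (f ω).re * (g ω).re ∂P - (∫ ω, (f ω).re ∂P) * ∫ ω, (g ω).re ∂P) -
      (∫ ω, (f ω).im * (g ω).im ∂P - (∫ ω, (f ω).im ∂P) * ∫ ω, (g ω).im ∂P) := by
    rw [Complex.sub_re, Complex.mul_re, re_int hfgi, re_int hfi, re_int hgi, im_int hfi,
      im_int hgi]
    simp only [Complex.mul_re]
    rw [integral_sub (hmul (hfr.mono h₁ le_rfl) (hgr.mono h₂ le_rfl) bfr bgr)
      (hmul (hfim.mono h₁ le_rfl) (hgim.mono h₂ le_rfl) bfi bgi)]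
    ring
  have him : (∫ ω, f ω * g ω ∂P - (∫ ω, f ω ∂P) * ∫ ω, g ω ∂P).im =
      (∫ ω, (f ω).re * (g ω).im ∂P - (∫ ω, (f ω).re ∂P) * ∫ ω, (g ω).im ∂P) +
      (∫ ω, (f ω).im * (g ω).re ∂P - (∫ ω, (f ω).im ∂P) * ∫ ω, (g ω).re ∂P) := by
    rw [Complex.sub_im, Complex.mul_im, im_int hfgi, re_int hfi, re_int hgi, im_int hfi,
      im_int hgi]
    simp only [Complex.mul_im]
    rw [integral_add (hmul (hfr.mono h₁ le_rfl) (hgim.mono h₂ le_rfl) bfr bgi)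
      (hmul (hfim.mono h₁ le_rfl) (hgr.mono h₂ le_rfl) bfi bgr)]
    ring
  rw [hre, him]
  refine (add_le_add (abs_sub _ _) (abs_add_le _ _)).trans ?_
  linarith

end CovarianceInequality

/-! ### The strong mixing coefficients -/

section AlphaCoeff

variable {Ω : Type*} [MeasurableSpace Ω] {P : Measure Ω} {d : ℕ}
  {X : ℤ → Ω → EuclideanSpace ℝ (Fin d)}

/-- The sigma-algebra generated by the process at the times in `T`. -/
abbrev sigmaAt (X : ℤ → Ω → EuclideanSpace ℝ (Fin d)) (T : Set ℤ) : MeasurableSpace Ω :=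
  ⨆ t ∈ T, MeasurableSpace.comap (X t) inferInstance

theorem sigmaAt_le (hX : ∀ t, Measurable (X t)) (T : Set ℤ) :
    sigmaAt X T ≤ (inferInstance : MeasurableSpace Ω) :=
  iSup₂_le fun t _ => (hX t).comap_le

omit [MeasurableSpace Ω] in
theorem measurable_sigmaAt {T : Set ℤ} {t : ℤ} (ht : t ∈ T) : Measurable[sigmaAt X T] (X t) :=
  Measurable.mono (comap_measurable (X t))
    (le_iSup₂_of_le (f := fun t (_ : t ∈ T) => MeasurableSpace.comap (X t) inferInstance)
      t ht le_rfl) le_rfl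

theorem mixingBound_alphaCoeff [IsProbabilityMeasure P] (s : ℤ) (h : ℕ) :
    MixingBound (sigmaAt X (Set.Iic s)) (sigmaAt X (Set.Ici (s + h))) P (alphaCoeff P X h) := by
  intro A B hA hB
  -- A real `sSup` dominates its set only when that set is bounded above; here 1 is a bound.
  refine le_csSup ⟨1, ?_⟩ ⟨s, A, B, hA, hB, rfl⟩
  rintro x ⟨s, A, B, -, -, rfl⟩
  have h1 : P.real (A ∩ B) ≤ 1 := measureReal_le_one
  have h2 : P.real A * P.real B ≤ 1 :=
    mul_le_one₀ measureReal_le_one measureReal_nonneg measureReal_le_one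
  have h3 : 0 ≤ P.real (A ∩ B) := measureReal_nonneg
  have h4 : 0 ≤ P.real A * P.real B := mul_nonneg measureReal_nonneg measureReal_nonneg
  exact abs_le.2 ⟨by linarith, by linarith⟩

theorem alphaCoeff_nonneg [IsProbabilityMeasure P] (h : ℕ) : 0 ≤ alphaCoeff P X h :=
  (abs_nonneg _).trans (mixingBound_alphaCoeff (X := X) (P := P) 0 h ∅ ∅
    (@MeasurableSet.empty _ (sigmaAt X _)) (@MeasurableSet.empty _ (sigmaAt X _)))

end AlphaCoeff

/-! ### Tannery's theorem for sums over lags -/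

section Tannery

variable {u : ℕ → ℕ → ℝ} {v : ℕ → ℝ}

theorem sum_abs_Ico_le_of_tail (hlim : ∀ h, Tendsto (fun n => u n h) atTop (𝓝 (v h))) {k : ℕ}
    {ε : ℝ} (htail : ∀ᶠ n in atTop, ∀ N, ∑ h ∈ Finset.Ico k N, |u n h| ≤ ε) (N : ℕ) :
    ∑ h ∈ Finset.Ico k N, |v h| ≤ ε :=
  le_of_tendsto (tendsto_finsetSum _ fun h _ => (hlim h).abs) (htail.mono fun _ hn => hn N)

theorem summable_of_tail (hlim : ∀ h, Tendsto (fun n => u n h) atTop (𝓝 (v h)))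
    (htail : ∀ ε : ℝ, 0 < ε → ∃ k, ∀ᶠ n in atTop, ∀ N, ∑ h ∈ Finset.Ico k N, |u n h| ≤ ε) :
    Summable v := by
  obtain ⟨k, hk⟩ := htail 1 one_pos
  refine Summable.of_abs (summable_of_sum_range_le (c := ∑ h ∈ Finset.range k, |v h| + 1)
    (fun h => abs_nonneg _) fun N => ?_)
  calc ∑ h ∈ Finset.range N, |v h| ≤ ∑ h ∈ Finset.range (max k N), |v h| :=
        Finset.sum_le_sum_of_subset_of_nonneg (by simp) fun h _ _ => abs_nonneg _
    _ = ∑ h ∈ Finset.range k, |v h| + ∑ h ∈ Finset.Ico k (max k N), |v h| :=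
        (Finset.sum_range_add_sum_Ico _ (le_max_left _ _)).symm
    _ ≤ _ := by gcongr; exact sum_abs_Ico_le_of_tail hlim hk _

/-- For large `n` the tail bound holds for all `N` at once, so the upper limit of summation may be
any `L n` tending to infinity. -/
theorem tendsto_sum_range_of_tail (hlim : ∀ h, Tendsto (fun n => u n h) atTop (𝓝 (v h)))
    (htail : ∀ ε : ℝ, 0 < ε → ∃ k, ∀ᶠ n in atTop, ∀ N, ∑ h ∈ Finset.Ico k N, |u n h| ≤ ε)
    {L : ℕ → ℕ} (hL : Tendsto L atTop atTop) :
    Tendsto (fun n => ∑ h ∈ Finset.range (L n), u n h) atTop (𝓝 (∑' h, v h)) := by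
  have hs := summable_of_tail hlim htail
  rw [Metric.tendsto_nhds]
  intro ε hε
  obtain ⟨k, hk⟩ := htail (ε / 4) (by positivity)
  have h1 : |∑' h, v h - ∑ h ∈ Finset.range k, v h| ≤ ε / 4 := by
    refine le_of_tendsto ((hs.hasSum.tendsto_sum_nat.sub_const _).abs) ?_
    filter_upwards [eventually_ge_atTop k] with N hN
    rw [← Finset.sum_range_add_sum_Ico _ hN, add_sub_cancel_left]
    exact (Finset.abs_sum_le_sum_abs _ _).trans (sum_abs_Ico_le_of_tail hlim hk N)
  have h2 := Metric.tendsto_nhds.1 (tendsto_finsetSum (Finset.range k) fun h _ => hlim h) (ε / 4)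
    (by positivity)
  filter_upwards [hk, h2, hL.eventually_ge_atTop k] with n hn1 hn2 hn3
  rw [Real.dist_eq] at hn2 ⊢
  rw [← Finset.sum_range_add_sum_Ico _ hn3]
  have h3 := (Finset.abs_sum_le_sum_abs (u n) (Finset.Ico k (L n))).trans (hn1 (L n))
  rw [abs_le] at h1 h3
  rw [abs_lt] at hn2 ⊢
  constructor <;> linarith [h1.1, h1.2, h3.1, h3.2, hn2.1, hn2.2]

theorem eventually_sum_range_abs_le (hlim : ∀ h, Tendsto (fun n => u n h) atTop (𝓝 (v h)))
    (htail : ∀ ε : ℝ, 0 < ε → ∃ k, ∀ᶠ n in atTop, ∀ N, ∑ h ∈ Finset.Ico k N, |u n h| ≤ ε) :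
    ∃ K : ℝ, 0 < K ∧ ∀ᶠ n in atTop, ∀ N, ∑ h ∈ Finset.range N, |u n h| ≤ K := by
  obtain ⟨k, hk⟩ := htail 1 one_pos
  have h1 := (tendsto_finsetSum (Finset.range k) fun h _ => (hlim h).abs).eventually_le_const
    (lt_add_one _)
  refine ⟨∑ h ∈ Finset.range k, |v h| + 1 + 1,
    by have := Finset.sum_nonneg fun h (_ : h ∈ Finset.range k) => abs_nonneg (v h); linarith, ?_⟩
  filter_upwards [hk, h1] with n hn1 hn2 N
  calc ∑ h ∈ Finset.range N, |u n h| ≤ ∑ h ∈ Finset.range (max k N), |u n h| :=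
        Finset.sum_le_sum_of_subset_of_nonneg (by simp) fun h _ _ => abs_nonneg _
    _ = ∑ h ∈ Finset.range k, |u n h| + ∑ h ∈ Finset.Ico k (max k N), |u n h| :=
        (Finset.sum_range_add_sum_Ico _ (le_max_left _ _)).symm
    _ ≤ _ := add_le_add hn2 (hn1 _)

end Tannery

/-! ### Double sums depending on a time difference -/

section DistSums

/-- The multiplicity of the lag `h`: lag `0` counts once, every other lag twice. -/
def lagWeight (h : ℕ) : ℝ := if h = 0 then 1 else 2

theorem lagWeight_nonneg (h : ℕ) : 0 ≤ lagWeight h := by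
  unfold lagWeight; split_ifs <;> norm_num

theorem lagWeight_le (h : ℕ) : lagWeight h ≤ 2 := by
  unfold lagWeight; split_ifs <;> norm_num

/-- Pairs are counted by their distance. In the induction, the new row, column and corner together
add ∑ `lagWeight t * g t`. -/
theorem sum_sum_dist (g : ℕ → ℝ) (L : ℕ) :
    ∑ s ∈ Finset.range L, ∑ t ∈ Finset.range L, g (Nat.dist s t) =
      ∑ h ∈ Finset.range L, ((L : ℝ) - h) * (lagWeight h * g h) := by
  induction L with
  | zero => simp
  | succ L ih =>
    have h1 : ∑ s ∈ Finset.range L, g (Nat.dist s L) = ∑ h ∈ Finset.range L, g (h + 1) := by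
      rw [← Finset.sum_range_reflect (fun h => g (h + 1))]
      refine Finset.sum_congr rfl fun s hs => ?_
      have := Finset.mem_range.1 hs
      congr 1
      rw [Nat.dist_eq_sub_of_le this.le]
      omega
    have h2 : ∑ t ∈ Finset.range (L + 1), lagWeight t * g t =
        2 * ∑ h ∈ Finset.range L, g (h + 1) + g 0 := by
      rw [Finset.sum_range_succ', Finset.mul_sum]
      simp [lagWeight]
    have h3 : ∑ h ∈ Finset.range (L + 1), (((L + 1 : ℕ) : ℝ) - h) * (lagWeight h * g h) =
        ∑ h ∈ Finset.range (L + 1), ((L : ℝ) - h) * (lagWeight h * g h) +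
          ∑ h ∈ Finset.range (L + 1), lagWeight h * g h := by
      rw [← Finset.sum_add_distrib]
      refine Finset.sum_congr rfl fun h _ => ?_
      push_cast
      ring
    rw [h3, h2, Finset.sum_range_succ (fun h => ((L : ℝ) - h) * (lagWeight h * g h)), ← ih]
    simp only [Finset.sum_range_succ, Finset.sum_add_distrib]
    simp only [Nat.dist_comm L, h1, Nat.dist_self]
    ring

/-- At most two times t lie at a given distance from `s`. -/
theorem sum_dist_le (g : ℕ → ℝ) (hg : ∀ h, 0 ≤ g h) {N s : ℕ} (hs : s < N) :
    ∑ t ∈ Finset.range N, g (Nat.dist s t) ≤ 2 * ∑ h ∈ Finset.range N, g h := by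
  have hmaps : ∀ t ∈ Finset.range N, Nat.dist s t ∈ Finset.range N := fun t ht => by
    simp only [Finset.mem_range, Nat.dist] at *
    omega
  rw [← Finset.sum_fiberwise_of_maps_to hmaps, Finset.mul_sum]
  refine Finset.sum_le_sum fun h _ => ?_
  rw [Finset.sum_congr rfl fun t ht => by rw [(Finset.mem_filter.1 ht).2], Finset.sum_const,
    nsmul_eq_mul]
  refine mul_le_mul_of_nonneg_right ?_ (hg h)
  have : (Finset.range N).filter (fun t => Nat.dist s t = h) ⊆ {s - h, s + h} := fun t ht => by
    have := (Finset.mem_filter.1 ht).2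
    simp only [Finset.mem_insert, Finset.mem_singleton, Nat.dist] at *
    omega
  exact_mod_cast (Finset.card_le_card this).trans Finset.card_le_two

end DistSums

/-! ### Moments of centred exceedance indicators -/

section Exceedance

variable {Ω : Type*} [MeasurableSpace Ω] {P : Measure Ω} {d : ℕ}
  {X : ℤ → Ω → EuclideanSpace ℝ (Fin d)} {D : Set (EuclideanSpace ℝ (Fin d))}

/-- The centred indicator of the event `X_t ∈ D`. -/
noncomputable def centred (P : Measure Ω) (X : ℤ → Ω → EuclideanSpace ℝ (Fin d))
    (D : Set (EuclideanSpace ℝ (Fin d))) (t : ℤ) (ω : Ω) : ℝ :=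
  D.indicator (fun _ => (1 : ℝ)) (X t ω) - P.real (X 0 ⁻¹' D)

/-- The covariance at lag `h` of the indicators of `X_t ∈ D`. -/
noncomputable def lagCov (P : Measure Ω) (X : ℤ → Ω → EuclideanSpace ℝ (Fin d))
    (D : Set (EuclideanSpace ℝ (Fin d))) (h : ℕ) : ℝ :=
  P.real (X 0 ⁻¹' D ∩ X h ⁻¹' D) - P.real (X 0 ⁻¹' D) ^ 2

theorem measurable_centred_sigmaAt (hD : MeasurableSet D) {T : Set ℤ} {t : ℤ} (ht : t ∈ T) :
    Measurable[sigmaAt X T] (centred P X D t) :=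
  ((measurable_const.indicator hD).comp (measurable_sigmaAt ht)).sub_const _

theorem measurable_centred (hX : ∀ t, Measurable (X t)) (hD : MeasurableSet D) (t : ℤ) :
    Measurable (centred P X D t) :=
  ((measurable_const.indicator hD).comp (hX t)).sub_const _

theorem abs_centred_le [IsProbabilityMeasure P] (t : ℤ) (ω : Ω) : |centred P X D t ω| ≤ 1 := by
  have h0 : 0 ≤ P.real (X 0 ⁻¹' D) := measureReal_nonneg
  have h1 : P.real (X 0 ⁻¹' D) ≤ 1 := measureReal_le_one
  unfold centred
  by_cases h : X t ω ∈ D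
  · rw [Set.indicator_of_mem h, abs_le]; constructor <;> linarith
  · rw [Set.indicator_of_notMem h, abs_le]; constructor <;> linarith

theorem StrictlyStationary.measureReal_preimage (hstat : StrictlyStationary P X)
    (hD : MeasurableSet D) (t : ℤ) : P.real (X t ⁻¹' D) = P.real (X 0 ⁻¹' D) := by
  have := hstat.measureReal_eq t (S := {f | f 0 ∈ D}) (measurable_pi_apply 0 hD)
  simp only [Set.mem_ofPred_eq, zero_add] at this
  exact this

theorem StrictlyStationary.measureReal_preimage_inter (hstat : StrictlyStationary P X)
    (hD : MeasurableSet D) (s t : ℕ) :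
    P.real (X s ⁻¹' D ∩ X t ⁻¹' D) = P.real (X 0 ⁻¹' D ∩ X (Nat.dist s t) ⁻¹' D) := by
  wlog h : s ≤ t generalizing s t
  · rw [Set.inter_comm, Nat.dist_comm]
    exact this t s (le_of_not_ge h)
  have := hstat.measureReal_eq s (S := {f | f 0 ∈ D} ∩ {f | f (Nat.dist s t : ℕ) ∈ D})
    ((measurable_pi_apply 0 hD).inter (measurable_pi_apply _ hD))
  have e : ((Nat.dist s t : ℕ) : ℤ) + s = t := by
    rw [Nat.dist_eq_sub_of_le h]; push_cast [h]; ring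
  simp only [Set.mem_inter_iff, Set.mem_ofPred_eq, zero_add, e] at this
  exact this

omit [MeasurableSpace Ω] in
theorem indicator_comp_eq (t : ℤ) :
    (fun ω => D.indicator (fun _ => (1 : ℝ)) (X t ω)) = (X t ⁻¹' D).indicator 1 := by
  funext ω
  by_cases h : X t ω ∈ D <;> simp [h]

theorem integral_indicator_comp (hX : ∀ t, Measurable (X t)) (hD : MeasurableSet D) (t : ℤ) :
    ∫ ω, D.indicator (fun _ => (1 : ℝ)) (X t ω) ∂P = P.real (X t ⁻¹' D) := by
  rw [indicator_comp_eq, integral_indicator_one (hX t hD)]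

theorem integrable_indicator_comp [IsProbabilityMeasure P] (hX : ∀ t, Measurable (X t))
    (hD : MeasurableSet D) (t : ℤ) :
    Integrable (fun ω => D.indicator (fun _ => (1 : ℝ)) (X t ω)) P := by
  rw [indicator_comp_eq]
  exact (integrable_const (1 : ℝ)).indicator (hX t hD)

theorem integrable_centred [IsProbabilityMeasure P] (hX : ∀ t, Measurable (X t))
    (hD : MeasurableSet D) (t : ℤ) : Integrable (centred P X D t) P :=
  (integrable_indicator_comp hX hD t).sub (integrable_const _)

theorem integral_centred [IsProbabilityMeasure P] (hX : ∀ t, Measurable (X t))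
    (hstat : StrictlyStationary P X) (hD : MeasurableSet D) (t : ℤ) :
    ∫ ω, centred P X D t ω ∂P = 0 := by
  unfold centred
  rw [integral_sub (integrable_indicator_comp hX hD t) (integrable_const _),
    integral_indicator_comp hX hD, hstat.measureReal_preimage hD t]
  simp

theorem integral_abs_centred_le [IsProbabilityMeasure P] (hX : ∀ t, Measurable (X t))
    (hstat : StrictlyStationary P X) (hD : MeasurableSet D) (t : ℤ) :
    ∫ ω, |centred P X D t ω| ∂P ≤ 2 * P.real (X 0 ⁻¹' D) := by
  calc ∫ ω, |centred P X D t ω| ∂P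
      ≤ ∫ ω, (D.indicator (fun _ => (1 : ℝ)) (X t ω) + P.real (X 0 ⁻¹' D)) ∂P := by
        refine integral_mono (integrable_centred hX hD t).abs
          ((integrable_indicator_comp hX hD t).add (integrable_const _)) fun ω => ?_
        refine (abs_sub _ _).trans_eq ?_
        rw [abs_of_nonneg (Set.indicator_nonneg (fun _ _ => zero_le_one) _),
          abs_of_nonneg measureReal_nonneg]
    _ = 2 * P.real (X 0 ⁻¹' D) := by
        rw [integral_add (integrable_indicator_comp hX hD t) (integrable_const _),
          integral_indicator_comp hX hD, hstat.measureReal_preimage hD t]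
        simp; ring

theorem integrable_centred_mul [IsProbabilityMeasure P] (hX : ∀ t, Measurable (X t))
    (hD : MeasurableSet D) (s t : ℤ) :
    Integrable (fun ω => centred P X D s ω * centred P X D t ω) P :=
  integrable_of_abs_le ((measurable_centred hX hD s).mul (measurable_centred hX hD t))
    (b := 1) fun ω => by
      rw [abs_mul]
      exact mul_le_one₀ (abs_centred_le s ω) (abs_nonneg _) (abs_centred_le t ω)

theorem integral_centred_mul [IsProbabilityMeasure P] (hX : ∀ t, Measurable (X t))
    (hstat : StrictlyStationary P X) (hD : MeasurableSet D) (s t : ℕ) :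
    ∫ ω, centred P X D s ω * centred P X D t ω ∂P = lagCov P X D (Nat.dist s t) := by
  set p := P.real (X 0 ⁻¹' D) with hp
  have e1 : ∀ ω, centred P X D s ω * centred P X D t ω =
      (X s ⁻¹' D ∩ X t ⁻¹' D).indicator 1 ω - p * centred P X D s ω
        - p * D.indicator (fun _ => (1 : ℝ)) (X t ω) := fun ω => by
    unfold centred
    by_cases h1 : X s ω ∈ D <;> by_cases h2 : X t ω ∈ D <;> simp [h1, h2, ← hp] <;> ring_nf
  have i1 : Integrable (fun ω => (X s ⁻¹' D ∩ X t ⁻¹' D).indicator (1 : Ω → ℝ) ω) P :=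
    (integrable_const (1 : ℝ)).indicator ((hX s hD).inter (hX t hD))
  have i2 : Integrable (fun ω => p * centred P X D s ω) P := (integrable_centred hX hD s).const_mul p
  have i3 := (integrable_indicator_comp (P := P) hX hD t).const_mul p
  have i12 : Integrable (fun ω => (X s ⁻¹' D ∩ X t ⁻¹' D).indicator (1 : Ω → ℝ) ω -
    p * centred P X D s ω) P := i1.sub i2
  rw [integral_congr_ae (ae_of_all _ e1), integral_sub i12 i3, integral_sub i1 i2,
    integral_indicator_one ((hX s hD).inter (hX t hD)), integral_const_mul, integral_const_mul,
    integral_centred hX hstat hD, integral_indicator_comp hX hD, hstat.measureReal_preimage hD t,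
    hstat.measureReal_preimage_inter hD, lagCov]
  ring

theorem abs_lagCov_le_alphaCoeff [IsProbabilityMeasure P] (hstat : StrictlyStationary P X)
    (hD : MeasurableSet D) (h : ℕ) : |lagCov P X D h| ≤ alphaCoeff P X h := by
  have := mixingBound_alphaCoeff (P := P) (X := X) 0 h (X 0 ⁻¹' D) (X h ⁻¹' D)
    (measurable_sigmaAt (by simp) hD) (measurable_sigmaAt (by simp) hD)
  rwa [hstat.measureReal_preimage hD h, ← sq] at this

theorem abs_lagCov_le (h : ℕ) : |lagCov P X D h| ≤
    P.real (X 0 ⁻¹' D ∩ X h ⁻¹' D) + P.real (X 0 ⁻¹' D) ^ 2 := by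
  refine (abs_sub _ _).trans_eq ?_
  rw [abs_of_nonneg measureReal_nonneg, abs_of_nonneg (sq_nonneg _)]

theorem integral_sq_sum_centred [IsProbabilityMeasure P] (hX : ∀ t, Measurable (X t))
    (hstat : StrictlyStationary P X) (hD : MeasurableSet D) (T : Finset ℕ) :
    ∫ ω, (∑ t ∈ T, centred P X D t ω) ^ 2 ∂P =
      ∑ s ∈ T, ∑ t ∈ T, lagCov P X D (Nat.dist s t) := by
  simp only [sq, Finset.sum_mul_sum]
  rw [integral_finsetSum T fun s _ => integrable_finsetSum T fun t _ =>
    integrable_centred_mul (P := P) hX hD s t]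
  refine Finset.sum_congr rfl fun s _ => ?_
  rw [integral_finsetSum T fun t _ => integrable_centred_mul (P := P) hX hD s t]
  exact Finset.sum_congr rfl fun t _ => integral_centred_mul hX hstat hD s t

/-- The bound is linear in the number of times, however they are placed. It serves both for blocks
and for the scattered times left outside them. -/
theorem integral_sq_sum_centred_le [IsProbabilityMeasure P] (hX : ∀ t, Measurable (X t))
    (hstat : StrictlyStationary P X) (hD : MeasurableSet D) {T : Finset ℕ} {N : ℕ}
    (hT : T ⊆ Finset.range N) :
    ∫ ω, (∑ t ∈ T, centred P X D t ω) ^ 2 ∂P ≤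
      T.card * (2 * ∑ h ∈ Finset.range N, |lagCov P X D h|) := by
  rw [integral_sq_sum_centred hX hstat hD, ← nsmul_eq_mul]
  refine Finset.sum_le_card_nsmul _ _ _ fun s hs => ?_
  calc ∑ t ∈ T, lagCov P X D (Nat.dist s t) ≤ ∑ t ∈ T, |lagCov P X D (Nat.dist s t)| :=
        Finset.sum_le_sum fun t _ => le_abs_self _
    _ ≤ ∑ t ∈ Finset.range N, |lagCov P X D (Nat.dist s t)| :=
        Finset.sum_le_sum_of_subset_of_nonneg hT fun _ _ _ => abs_nonneg _
    _ ≤ _ := sum_dist_le _ (fun h => abs_nonneg _) (Finset.mem_range.1 (hT hs))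

theorem integral_sq_block [IsProbabilityMeasure P] (hX : ∀ t, Measurable (X t))
    (hstat : StrictlyStationary P X) (hD : MeasurableSet D) (L : ℕ) :
    ∫ ω, (∑ t ∈ Finset.range L, centred P X D t ω) ^ 2 ∂P =
      ∑ h ∈ Finset.range L, ((L : ℝ) - h) * (lagWeight h * lagCov P X D h) := by
  rw [integral_sq_sum_centred hX hstat hD, sum_sum_dist]

end Exceedance

/-! ### Combinatorics of quadruple sums -/

section QuadrupleSums

/-- Sorting a tuple does not change `G`, so `G f` is at most one of the 24 terms `B (f ∘ σ)`; for
each fixed σ these sum to the same total. -/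
theorem sum_le_of_sort {L : ℕ} {G B : (Fin 4 → Fin L) → ℝ}
    (hsymm : ∀ (σ : Equiv.Perm (Fin 4)) f, G (f ∘ σ) = G f) (hB0 : ∀ f, 0 ≤ B f)
    (hGB : ∀ f, Monotone f → G f ≤ B f) : ∑ f, G f ≤ 24 * ∑ f, B f := by
  calc ∑ f, G f ≤ ∑ f : Fin 4 → Fin L, ∑ σ : Equiv.Perm (Fin 4), B (f ∘ σ) := by
        refine Finset.sum_le_sum fun f _ => ?_
        rw [← hsymm (Tuple.sort f) f]
        exact (hGB _ (Tuple.monotone_sort f)).trans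
          (Finset.single_le_sum (f := fun σ : Equiv.Perm (Fin 4) => B (f ∘ σ))
            (fun σ _ => hB0 _) (Finset.mem_univ _))
    _ = ∑ σ : Equiv.Perm (Fin 4), ∑ f : Fin 4 → Fin L, B (f ∘ σ) := Finset.sum_comm
    _ = ∑ _σ : Equiv.Perm (Fin 4), ∑ f, B f := by
        refine Finset.sum_congr rfl fun σ _ => ?_
        exact Equiv.sum_comp (Equiv.arrowCongr σ.symm (Equiv.refl (Fin L))) B
    _ = 24 * ∑ f, B f := by
        rw [Finset.sum_const, nsmul_eq_mul, Finset.card_univ, Fintype.card_perm, Fintype.card_fin]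
        norm_num [Nat.factorial]

theorem sum_fin_succ_arrow {ι : Type*} [Fintype ι] {n : ℕ} (F : (Fin (n + 1) → ι) → ℝ) :
    ∑ f, F f = ∑ i, ∑ g : Fin n → ι, F (Fin.cons i g) := by
  rw [← Equiv.sum_comp (Fin.consEquiv fun _ : Fin (n + 1) => ι) F, Fintype.sum_prod_type]
  rfl

theorem sum_fin_four_arrow {ι : Type*} [Fintype ι] (F : ι → ι → ι → ι → ℝ) :
    ∑ f : Fin 4 → ι, F (f 0) (f 1) (f 2) (f 3) = ∑ i, ∑ j, ∑ k, ∑ l, F i j k l := by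
  rw [sum_fin_succ_arrow]
  refine Finset.sum_congr rfl fun i _ => ?_
  rw [sum_fin_succ_arrow]
  refine Finset.sum_congr rfl fun j _ => ?_
  rw [sum_fin_succ_arrow]
  refine Finset.sum_congr rfl fun k _ => ?_
  rw [sum_fin_succ_arrow]
  refine Finset.sum_congr rfl fun l _ => ?_
  rw [Fintype.sum_unique]
  rfl

theorem sum_fin_dist_le {L : ℕ} (g : ℕ → ℝ) (hg : ∀ h, 0 ≤ g h) (i : Fin L) :
    ∑ j : Fin L, g (Nat.dist i j) ≤ 2 * ∑ h ∈ Finset.range L, g h := by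
  rw [Fin.sum_univ_eq_sum_range fun j => g (Nat.dist i j)]
  exact sum_dist_le g hg i.2

theorem sum_fin_window_le {L : ℕ} (r i : ℕ) :
    ∑ j : Fin L, (if i ≤ (j : ℕ) ∧ (j : ℕ) < i + r then (1 : ℝ) else 0) ≤ r := by
  rw [Fin.sum_univ_eq_sum_range fun j => if i ≤ j ∧ j < i + r then (1 : ℝ) else 0,
    Finset.sum_boole]
  have : (Finset.range L).filter (fun j => i ≤ j ∧ j < i + r) ⊆ Finset.Ico i (i + r) := fun j hj =>
    Finset.mem_Ico.2 (Finset.mem_filter.1 hj).2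
  have := Finset.card_le_card this
  rw [Nat.card_Ico, Nat.add_sub_cancel_left] at this
  exact_mod_cast this

/-- The three windows leave one free index and at most `r` choices for each of the others. Each `β`
term leaves two free indices beyond its pair; the constant 24 is 4, times three pairs, times the 2
of `sum_fin_dist_le`. The last term factors into a square. -/
theorem sum_quadruple_le {L r : ℕ} {p : ℝ} (hp : 0 ≤ p) {β γ : ℕ → ℝ} (hβ : ∀ h, 0 ≤ β h) :
    ∑ i : Fin L, ∑ j : Fin L, ∑ k : Fin L, ∑ l : Fin L,
      (p * ((if (i : ℕ) ≤ (j : ℕ) ∧ (j : ℕ) < i + r then (1 : ℝ) else 0) *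
          ((if (j : ℕ) ≤ (k : ℕ) ∧ (k : ℕ) < j + r then (1 : ℝ) else 0) *
            (if (k : ℕ) ≤ (l : ℕ) ∧ (l : ℕ) < k + r then (1 : ℝ) else 0))) +
        4 * (β (Nat.dist i j) + β (Nat.dist j k) + β (Nat.dist k l)) +
        γ (Nat.dist i j) * γ (Nat.dist k l)) ≤
    p * (L * (r : ℝ) ^ 3) + 24 * (L ^ 3 * ∑ h ∈ Finset.range L, β h) +
      (∑ i : Fin L, ∑ j : Fin L, γ (Nat.dist i j)) ^ 2 := by
  have hwin : ∀ i : Fin L, ∑ j : Fin L, ((if (i : ℕ) ≤ (j : ℕ) ∧ (j : ℕ) < i + r then (1 : ℝ)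
      else 0) * ((r : ℝ) * r)) ≤ r * (r * r) := fun i => by
    rw [← Finset.sum_mul]
    exact mul_le_mul_of_nonneg_right (sum_fin_window_le r i) (by positivity)
  have hwin' : ∀ i : Fin L, ∑ j : Fin L, ((if (i : ℕ) ≤ (j : ℕ) ∧ (j : ℕ) < i + r then (1 : ℝ)
      else 0) * (r : ℝ)) ≤ r * r := fun i => by
    rw [← Finset.sum_mul]
    exact mul_le_mul_of_nonneg_right (sum_fin_window_le r i) (by positivity)
  have h1 : ∑ i : Fin L, ∑ j : Fin L, ∑ k : Fin L, ∑ l : Fin L,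
      (if (i : ℕ) ≤ (j : ℕ) ∧ (j : ℕ) < i + r then (1 : ℝ) else 0) *
          ((if (j : ℕ) ≤ (k : ℕ) ∧ (k : ℕ) < j + r then (1 : ℝ) else 0) *
            (if (k : ℕ) ≤ (l : ℕ) ∧ (l : ℕ) < k + r then (1 : ℝ) else 0)) ≤ L * (r : ℝ) ^ 3 := by
    simp only [← Finset.mul_sum]
    calc _ ≤ ∑ i : Fin L, ∑ j : Fin L,
          ((if (i : ℕ) ≤ (j : ℕ) ∧ (j : ℕ) < i + r then (1 : ℝ) else 0) * ((r : ℝ) * r)) := by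
          refine Finset.sum_le_sum fun i _ => Finset.sum_le_sum fun j _ =>
            mul_le_mul_of_nonneg_left ?_ (by positivity)
          refine le_trans (Finset.sum_le_sum fun k _ => ?_) (hwin' j)
          exact mul_le_mul_of_nonneg_left (sum_fin_window_le r k) (by positivity)
      _ ≤ ∑ _i : Fin L, (r : ℝ) * (r * r) := Finset.sum_le_sum fun i _ => hwin i
      _ = L * (r : ℝ) ^ 3 := by
          rw [Finset.sum_const, Finset.card_univ, Fintype.card_fin, nsmul_eq_mul]; ring
  set b := ∑ h ∈ Finset.range L, β h with hb
  have h2 : ∑ i : Fin L, ∑ j : Fin L, β (Nat.dist i j) ≤ L * (2 * b) := by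
    refine (Finset.sum_le_sum fun i _ => sum_fin_dist_le β hβ i).trans_eq ?_
    rw [Finset.sum_const, Finset.card_univ, Fintype.card_fin, nsmul_eq_mul]
  have e : ∑ i : Fin L, ∑ j : Fin L, ∑ k : Fin L, ∑ l : Fin L,
        (β (Nat.dist i j) + β (Nat.dist j k) + β (Nat.dist k l)) =
      3 * (L ^ 2 * ∑ i : Fin L, ∑ j : Fin L, β (Nat.dist i j)) := by
    simp only [Finset.sum_add_distrib, Finset.sum_const, Finset.card_univ, Fintype.card_fin,
      nsmul_eq_mul, ← Finset.mul_sum]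
    ring
  have e3 : ∑ i : Fin L, ∑ j : Fin L, ∑ k : Fin L, ∑ l : Fin L,
      γ (Nat.dist i j) * γ (Nat.dist k l) = (∑ i : Fin L, ∑ j : Fin L, γ (Nat.dist i j)) ^ 2 := by
    simp only [← Finset.mul_sum, ← Finset.sum_mul, sq]
  have split : ∀ A B E : Fin L → Fin L → Fin L → Fin L → ℝ,
      ∑ i, ∑ j, ∑ k, ∑ l, (p * A i j k l + 4 * B i j k l + E i j k l) =
        p * ∑ i, ∑ j, ∑ k, ∑ l, A i j k l + 4 * ∑ i, ∑ j, ∑ k, ∑ l, B i j k l +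
          ∑ i, ∑ j, ∑ k, ∑ l, E i j k l := fun A B E => by
    simp only [Finset.sum_add_distrib, Finset.mul_sum]
  refine (split
    (fun i j k l => (if (i : ℕ) ≤ (j : ℕ) ∧ (j : ℕ) < i + r then (1 : ℝ) else 0) *
      ((if (j : ℕ) ≤ (k : ℕ) ∧ (k : ℕ) < j + r then (1 : ℝ) else 0) *
        (if (k : ℕ) ≤ (l : ℕ) ∧ (l : ℕ) < k + r then (1 : ℝ) else 0)))
    (fun i j k l => β (Nat.dist i j) + β (Nat.dist j k) + β (Nat.dist k l))
    (fun i j k l => γ (Nat.dist i j) * γ (Nat.dist k l))).trans_le ?_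
  rw [e, e3]
  have h4 := mul_le_mul_of_nonneg_left h1 hp
  have h5 := mul_le_mul_of_nonneg_left h2 (by positivity : (0 : ℝ) ≤ 12 * L ^ 2)
  have h6 : 12 * (L : ℝ) ^ 2 * (L * (2 * b)) = 24 * (L ^ 3 * b) := by ring
  linarith

end QuadrupleSums

/-! ### Fourth moment of a block -/

section FourthMoment

variable {Ω : Type*} [MeasurableSpace Ω] {P : Measure Ω} {d : ℕ}
  {X : ℤ → Ω → EuclideanSpace ℝ (Fin d)} {D : Set (EuclideanSpace ℝ (Fin d))}

/-- The first gap of length at least `r` decides. A gap after `i` or before `l` isolates a factor of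
mean zero and leaves only the mixing error; a gap in the middle also leaves the product of two
covariances. Without such a gap, three factors are bounded by 1 and the first has L¹ norm at most 2
P(X_0 ∈ D). -/
theorem abs_integral_centred_four_le [IsProbabilityMeasure P] (hX : ∀ t, Measurable (X t))
    (hstat : StrictlyStationary P X) (hD : MeasurableSet D) {r i j k l : ℕ} {β : ℕ → ℝ}
    (hβ0 : ∀ h, 0 ≤ β h) (hβ : ∀ h, r ≤ h → β h = alphaCoeff P X h)
    (hij : i ≤ j) (hjk : j ≤ k) (hkl : k ≤ l) :
    |∫ ω, centred P X D i ω * centred P X D j ω * centred P X D k ω * centred P X D l ω ∂P| ≤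
      2 * P.real (X 0 ⁻¹' D) * ((if i ≤ j ∧ j < i + r then (1 : ℝ) else 0) *
          ((if j ≤ k ∧ k < j + r then (1 : ℝ) else 0) *
            (if k ≤ l ∧ l < k + r then (1 : ℝ) else 0))) +
        4 * (β (Nat.dist i j) + β (Nat.dist j k) + β (Nat.dist k l)) +
        |lagCov P X D (Nat.dist i j)| * |lagCov P X D (Nat.dist k l)| := by
  set Y := centred P X D with hY
  have hYm : ∀ (T : Set ℤ) (t : ℤ), t ∈ T → Measurable[sigmaAt X T] (Y t) :=
    fun T t ht => measurable_centred_sigmaAt hD ht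
  have hY1 : ∀ t ω, |Y t ω| ≤ 1 := fun t ω => abs_centred_le t ω
  have hmul : ∀ {x y : ℝ}, |x| ≤ 1 → |y| ≤ 1 → |x * y| ≤ 1 := fun hx hy => by
    rw [abs_mul]; exact mul_le_one₀ hx (abs_nonneg _) hy
  have hcc : 0 ≤ |lagCov P X D (Nat.dist i j)| * |lagCov P X D (Nat.dist k l)| :=
    mul_nonneg (abs_nonneg _) (abs_nonneg _)
  have hp : 0 ≤ P.real (X 0 ⁻¹' D) := measureReal_nonneg
  have hind : ∀ (q : Prop) [Decidable q], (0 : ℝ) ≤ if q then 1 else 0 := fun q _ => by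
    split_ifs <;> norm_num
  have hind0 := mul_nonneg (mul_nonneg (by norm_num : (0 : ℝ) ≤ 2) hp)
    (mul_nonneg (hind (i ≤ j ∧ j < i + r)) (mul_nonneg (hind (j ≤ k ∧ k < j + r))
      (hind (k ≤ l ∧ l < k + r))))
  have b1 := hβ0 (Nat.dist i j)
  have b2 := hβ0 (Nat.dist j k)
  have b3 := hβ0 (Nat.dist k l)
  have hz : ∀ t, ∫ ω, Y t ω ∂P = 0 := integral_centred hX hstat hD
  have hmem : ∀ {x y : ℕ} {g : ℕ}, x + g ≤ y → (y : ℤ) ∈ Set.Ici ((x : ℤ) + g) := fun h => by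
    rw [Set.mem_Ici]; exact_mod_cast h
  have hmem' : ∀ {x y : ℕ}, x ≤ y → (x : ℤ) ∈ Set.Iic (y : ℤ) := fun h => by
    rw [Set.mem_Iic]; exact_mod_cast h
  by_cases h1 : i + r ≤ j
  · have hd : Nat.dist i j = j - i := Nat.dist_eq_sub_of_le hij
    have hβ1 := hβ (Nat.dist i j) (by rw [hd]; omega)
    have key := (mixingBound_alphaCoeff (P := P) (X := X) i (Nat.dist i j)).abs_cov_le_four
      (sigmaAt_le hX _) (sigmaAt_le hX _) (f := Y i) (g := fun ω => Y j ω * Y k ω * Y l ω)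
      (hYm _ _ (hmem' le_rfl)) (hY1 i)
      (((hYm _ _ (hmem (by omega))).mul (hYm _ _ (hmem (by omega)))).mul
        (hYm _ _ (hmem (by omega)))) fun ω => hmul (hmul (hY1 _ _) (hY1 _ _)) (hY1 _ _)
    rw [hz, zero_mul, sub_zero, ← hβ1] at key
    simp only [mul_assoc] at key hind0 ⊢
    linarith
  by_cases h2 : j + r ≤ k
  · have hd : Nat.dist j k = k - j := Nat.dist_eq_sub_of_le hjk
    have hβ1 := hβ (Nat.dist j k) (by rw [hd]; omega)
    have key := (mixingBound_alphaCoeff (P := P) (X := X) j (Nat.dist j k)).abs_cov_le_four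
      (sigmaAt_le hX _) (sigmaAt_le hX _) (f := fun ω => Y i ω * Y j ω)
      (g := fun ω => Y k ω * Y l ω)
      ((hYm _ _ (hmem' hij)).mul (hYm _ _ (hmem' le_rfl))) (fun ω => hmul (hY1 _ _) (hY1 _ _))
      ((hYm _ _ (hmem (by omega))).mul (hYm _ _ (hmem (by omega))))
      fun ω => hmul (hY1 _ _) (hY1 _ _)
    rw [integral_centred_mul hX hstat hD, integral_centred_mul hX hstat hD, ← hβ1] at key
    rw [← abs_mul] at hcc ⊢
    simp only [mul_assoc] at key hind0 ⊢
    have := abs_sub_abs_le_abs_sub (∫ ω, Y i ω * (Y j ω * (Y k ω * Y l ω)) ∂P)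
      (lagCov P X D (Nat.dist i j) * lagCov P X D (Nat.dist k l))
    linarith
  by_cases h3 : k + r ≤ l
  · have hd : Nat.dist k l = l - k := Nat.dist_eq_sub_of_le hkl
    have hβ1 := hβ (Nat.dist k l) (by rw [hd]; omega)
    have key := (mixingBound_alphaCoeff (P := P) (X := X) k (Nat.dist k l)).abs_cov_le_four
      (sigmaAt_le hX _) (sigmaAt_le hX _) (f := fun ω => Y i ω * Y j ω * Y k ω) (g := Y l)
      (((hYm _ _ (hmem' (hij.trans hjk))).mul (hYm _ _ (hmem' hjk))).mul (hYm _ _ (hmem' le_rfl)))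
      (fun ω => hmul (hmul (hY1 _ _) (hY1 _ _)) (hY1 _ _))
      (hYm _ _ (hmem (by omega))) (hY1 l)
    rw [hz, mul_zero, sub_zero, ← hβ1] at key
    linarith
  rw [if_pos ⟨hij, by omega⟩, if_pos ⟨hjk, by omega⟩, if_pos ⟨hkl, by omega⟩]
  have h4 : |∫ ω, Y i ω * Y j ω * Y k ω * Y l ω ∂P| ≤ ∫ ω, |Y i ω| ∂P := by
    refine abs_integral_le_integral_abs.trans ?_
    refine integral_mono_of_nonneg (ae_of_all _ fun ω => abs_nonneg _)
      (integrable_centred hX hD i).abs (ae_of_all _ fun ω => ?_)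
    simp only [mul_assoc]
    rw [abs_mul]
    exact mul_le_of_le_one_right (abs_nonneg _) (hmul (hY1 _ _) (hmul (hY1 _ _) (hY1 _ _)))
  have h5 := integral_abs_centred_le (P := P) hX hstat hD i
  linarith

theorem integral_pow_four_block_le [IsProbabilityMeasure P] (hX : ∀ t, Measurable (X t))
    (hstat : StrictlyStationary P X) (hD : MeasurableSet D) (L r : ℕ) :
    ∫ ω, (∑ t ∈ Finset.range L, centred P X D t ω) ^ 4 ∂P ≤
      24 * (2 * P.real (X 0 ⁻¹' D) * (L * (r : ℝ) ^ 3) +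
        24 * (L ^ 3 * ∑ h ∈ Finset.Ico r L, alphaCoeff P X h) +
        (L * (2 * ∑ h ∈ Finset.range L, |lagCov P X D h|)) ^ 2) := by
  -- Vanishing below `r` leaves only the mixing coefficients from `r` on in the final sum.
  set β : ℕ → ℝ := fun h => if r ≤ h then alphaCoeff P X h else 0 with hβ
  have hβ0 : ∀ h, 0 ≤ β h := fun h => by
    simp only [hβ]; split_ifs
    exacts [alphaCoeff_nonneg h, le_rfl]
  have hβs : ∑ h ∈ Finset.range L, β h = ∑ h ∈ Finset.Ico r L, alphaCoeff P X h := by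
    rw [← Finset.sum_filter]
    refine Finset.sum_congr ?_ fun _ _ => rfl
    ext h
    simp [and_comm]
  have hYb : ∀ (f : Fin 4 → Fin L), Integrable (fun ω => ∏ i, centred P X D (f i : ℕ) ω) P :=
    fun f => integrable_of_abs_le
      (Finset.measurable_fun_prod _ fun i _ => measurable_centred hX hD _) (b := 1) fun ω => by
        rw [Finset.abs_prod]
        exact Finset.prod_le_one (fun i _ => abs_nonneg _) fun i _ => abs_centred_le _ ω
  calc ∫ ω, (∑ t ∈ Finset.range L, centred P X D t ω) ^ 4 ∂P
      = ∑ f : Fin 4 → Fin L, ∫ ω, ∏ i, centred P X D (f i : ℕ) ω ∂P := by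
        rw [← integral_finsetSum _ fun f _ => hYb f]
        refine integral_congr_ae (ae_of_all _ fun ω => ?_)
        simp only
        rw [← Fin.sum_univ_eq_sum_range fun t : ℕ => centred P X D t ω, Fintype.sum_pow]
    _ ≤ 24 * ∑ f : Fin 4 → Fin L, (2 * P.real (X 0 ⁻¹' D) *
          ((if (f 0 : ℕ) ≤ (f 1 : ℕ) ∧ (f 1 : ℕ) < f 0 + r then (1 : ℝ) else 0) *
          ((if (f 1 : ℕ) ≤ (f 2 : ℕ) ∧ (f 2 : ℕ) < f 1 + r then (1 : ℝ) else 0) *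
            (if (f 2 : ℕ) ≤ (f 3 : ℕ) ∧ (f 3 : ℕ) < f 2 + r then (1 : ℝ) else 0))) +
        4 * (β (Nat.dist (f 0) (f 1)) + β (Nat.dist (f 1) (f 2)) + β (Nat.dist (f 2) (f 3))) +
        |lagCov P X D (Nat.dist (f 0) (f 1))| * |lagCov P X D (Nat.dist (f 2) (f 3))|) := by
        refine sum_le_of_sort (fun σ f => ?_) (fun f => ?_) fun f hf => ?_
        · refine integral_congr_ae (ae_of_all _ fun ω => ?_)
          exact Equiv.prod_comp σ fun i => centred P X D (f i : ℕ) ω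
        · have h1 := hβ0 (Nat.dist (f 0) (f 1))
          have h2 := hβ0 (Nat.dist (f 1) (f 2))
          have h3 := hβ0 (Nat.dist (f 2) (f 3))
          have h4 : 0 ≤ P.real (X 0 ⁻¹' D) := measureReal_nonneg
          positivity
        · simp only [Fin.prod_univ_four]
          exact (le_abs_self _).trans (abs_integral_centred_four_le hX hstat hD hβ0
            (fun h hh => by simp [hβ, hh]) (hf (by decide)) (hf (by decide)) (hf (by decide)))
    _ ≤ _ := by
        refine mul_le_mul_of_nonneg_left ?_ (by norm_num)
        have := sum_quadruple_le (L := L) (r := r) (p := 2 * P.real (X 0 ⁻¹' D))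
          (mul_nonneg (by norm_num) measureReal_nonneg) (γ := fun h => |lagCov P X D h|) hβ0
        rw [hβs] at this
        refine ((sum_fin_four_arrow _).trans_le this).trans ?_
        gcongr
        refine (Finset.sum_le_sum fun i _ =>
          sum_fin_dist_le (fun h => |lagCov P X D h|) (fun _ => abs_nonneg _) i).trans_eq ?_
        simp

end FourthMoment

/-! ### Expansion and comparison of characteristic functions -/

section CharFunEstimates

/-- Taylor's formula handles |x| ≤ 1. For |x| ≥ 1 the triangle inequality suffices, as each term is
dominated by |x|³ and 1 + 1 + 1 + 1/2 ≤ 4. -/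
theorem norm_exp_ofReal_mul_I_sub_le (x : ℝ) :
    ‖Complex.exp (x * Complex.I) - (1 + x * Complex.I - (x : ℂ) ^ 2 / 2)‖ ≤ 4 * |x| ^ 3 := by
  have hn : ‖(x : ℂ) * Complex.I‖ = |x| := by simp
  have hsq : ((x : ℂ) * Complex.I) ^ 2 = -(x : ℂ) ^ 2 := by
    rw [mul_pow, Complex.I_sq]; ring
  rcases le_total |x| 1 with h | h
  · have := Complex.exp_bound (x := (x : ℂ) * Complex.I) (by rwa [hn]) (n := 3) (by norm_num)
    rw [hn] at this
    have e : ∑ k ∈ Finset.range 3, ((x : ℂ) * Complex.I) ^ k / (k.factorial : ℂ) =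
        1 + x * Complex.I - (x : ℂ) ^ 2 / 2 := by
      simp [Finset.sum_range_succ, hsq, Nat.factorial]
      ring
    rw [e] at this
    refine this.trans ?_
    rw [mul_comm]
    refine mul_le_mul_of_nonneg_right ?_ (by positivity)
    norm_num [Nat.factorial]
  · have h1 : ‖Complex.exp (x * Complex.I)‖ = 1 := Complex.norm_exp_ofReal_mul_I x
    have h2 : ‖(x : ℂ) ^ 2 / 2‖ = |x| ^ 2 / 2 := by simp
    have h3 : 1 ≤ |x| ^ 2 := one_le_pow₀ h
    have h4 : |x| ^ 2 ≤ |x| ^ 3 := pow_le_pow_right₀ h (by norm_num)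
    have h5 : |x| ≤ |x| ^ 2 := by nlinarith
    calc _ ≤ ‖Complex.exp (x * Complex.I)‖ + ((‖(1 : ℂ)‖ + ‖(x : ℂ) * Complex.I‖) +
          ‖(x : ℂ) ^ 2 / 2‖) := by
          refine (norm_sub_le _ _).trans ?_
          gcongr
          exact (norm_sub_le _ _).trans (add_le_add_left (norm_add_le _ _) _)
      _ ≤ _ := by rw [h1, h2, hn, norm_one]; linarith

/-- This trades third moments for second and fourth ones, with a weight δ that is sent to 0 only
after n → ∞. The difference of the two sides is x² (δ² - δ|x| + x²) / δ. -/
theorem abs_pow_three_le (x : ℝ) {δ : ℝ} (hδ : 0 < δ) : |x| ^ 3 ≤ δ * x ^ 2 + x ^ 4 / δ := by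
  have h1 : δ * x ^ 2 + x ^ 4 / δ - |x| ^ 3 =
      x ^ 2 * ((δ - |x| / 2) ^ 2 + 3 / 4 * |x| ^ 2) / δ := by
    have : x ^ 4 = |x| ^ 2 * x ^ 2 := by rw [sq_abs]; ring
    have h3 : |x| ^ 3 = |x| * x ^ 2 := by rw [← sq_abs x]; ring
    rw [this, h3]
    field_simp
    ring
  have h2 : 0 ≤ x ^ 2 * ((δ - |x| / 2) ^ 2 + 3 / 4 * |x| ^ 2) / δ := by positivity
  linarith

variable {Ω : Type*} [MeasurableSpace Ω] {P : Measure Ω} [IsProbabilityMeasure P]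

theorem integrable_pow_of_abs_le {Z : Ω → ℝ} (hZ : Measurable Z) {b : ℝ} (hb : ∀ ω, |Z ω| ≤ b)
    (k : ℕ) : Integrable (fun ω => Z ω ^ k) P :=
  integrable_of_abs_le (hZ.pow_const k) (b := b ^ k) fun ω => by
    rw [abs_pow]; exact pow_le_pow_left₀ (abs_nonneg _) (hb ω) k

theorem integrable_exp_mul_I {Z : Ω → ℝ} (hZ : Measurable Z) :
    Integrable (fun ω => Complex.exp (Z ω * Complex.I)) P :=
  Integrable.of_bound (by fun_prop : Measurable fun ω =>
      Complex.exp (Z ω * Complex.I)).aestronglyMeasurable 1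
    (ae_of_all _ fun ω => (Complex.norm_exp_ofReal_mul_I _).le)

theorem norm_integral_exp_sub_le {Z : Ω → ℝ} (hZ : Measurable Z) {b : ℝ} (hb : ∀ ω, |Z ω| ≤ b)
    (h0 : ∫ ω, Z ω ∂P = 0) {δ : ℝ} (hδ : 0 < δ) :
    ‖∫ ω, Complex.exp (Z ω * Complex.I) ∂P - (1 - ((∫ ω, Z ω ^ 2 ∂P : ℝ) : ℂ) / 2)‖ ≤
      4 * (δ * ∫ ω, Z ω ^ 2 ∂P + (∫ ω, Z ω ^ 4 ∂P) / δ) := by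
  have i1 : Integrable Z P := integrable_of_abs_le hZ hb
  have i2 : Integrable (fun ω => Z ω ^ 2) P := integrable_pow_of_abs_le hZ hb 2
  have i4 : Integrable (fun ω => Z ω ^ 4) P := integrable_pow_of_abs_le hZ hb 4
  have c0 : Integrable (fun ω => (Z ω : ℂ) * Complex.I) P := i1.ofReal.mul_const Complex.I
  have c1 : Integrable (fun ω => 1 + (Z ω : ℂ) * Complex.I) P :=
    (integrable_const (1 : ℂ)).add c0
  have c2 : Integrable (fun ω => (Z ω : ℂ) ^ 2 / 2) P := by
    have := (i2.ofReal (𝕜 := ℂ)).div_const 2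
    simpa using this
  have c3 : Integrable (fun ω => 1 + (Z ω : ℂ) * Complex.I - (Z ω : ℂ) ^ 2 / 2) P := c1.sub c2
  have e : ∫ ω, (1 + (Z ω : ℂ) * Complex.I - (Z ω : ℂ) ^ 2 / 2) ∂P =
      1 - ((∫ ω, Z ω ^ 2 ∂P : ℝ) : ℂ) / 2 := by
    rw [integral_sub c1 c2, integral_add (integrable_const _) c0,
      integral_mul_const, integral_div]
    have e2 : ∫ ω, (Z ω : ℂ) ∂P = 0 := by
      rw [integral_complex_ofReal, h0, Complex.ofReal_zero]
    have e3 : ∫ ω, (Z ω : ℂ) ^ 2 ∂P = ((∫ ω, Z ω ^ 2 ∂P : ℝ) : ℂ) := by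
      rw [← integral_complex_ofReal]
      simp
    rw [e2, e3]
    simp
  rw [← e, ← integral_sub (integrable_exp_mul_I hZ) c3]
  refine (norm_integral_le_of_norm_le (((i2.const_mul δ).add (i4.div_const δ)).const_mul 4)
    (ae_of_all _ fun ω => ?_)).trans_eq ?_
  · refine (norm_exp_ofReal_mul_I_sub_le _).trans ?_
    exact mul_le_mul_of_nonneg_left (abs_pow_three_le _ hδ) (by norm_num)
  · rw [integral_const_mul, ← integral_const_mul δ, ← integral_div]
    congr 1
    exact integral_add (i2.const_mul δ) (i4.div_const δ)

/-- The map x ↦ e^{ix} is 1-Lipschitz, and the L¹ norm is at most the L² norm because a variance is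
nonnegative. -/
theorem norm_integral_exp_sub_integral_exp_le {S T : Ω → ℝ} (hS : Measurable S)
    (hT : Measurable T) {b : ℝ} (hb : ∀ ω, |S ω - T ω| ≤ b) (u : ℝ) :
    ‖∫ ω, Complex.exp (((u * S ω : ℝ) : ℂ) * Complex.I) ∂P -
      ∫ ω, Complex.exp (((u * T ω : ℝ) : ℂ) * Complex.I) ∂P‖ ≤
        |u| * √(∫ ω, (S ω - T ω) ^ 2 ∂P) := by
  have hR : Measurable fun ω => S ω - T ω := hS.sub hT
  have i1 : Integrable (fun ω => |S ω - T ω|) P := (integrable_of_abs_le hR hb).abs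
  have hsq : ∫ ω, |S ω - T ω| ∂P ≤ √(∫ ω, (S ω - T ω) ^ 2 ∂P) := by
    refine Real.le_sqrt_of_sq_le ?_
    have hmem : MemLp (fun ω => |S ω - T ω|) 2 P := MemLp.of_bound
      (hR.abs).aestronglyMeasurable b (ae_of_all _ fun ω => by simpa using hb ω)
    have hv := variance_eq_sub hmem
    have hv0 := variance_nonneg (fun ω => |S ω - T ω|) P
    rw [hv] at hv0
    simp only [Pi.pow_apply, sq_abs] at hv0
    linarith
  rw [← integral_sub (integrable_exp_mul_I (hS.const_mul u))
    (integrable_exp_mul_I (hT.const_mul u))]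
  refine (norm_integral_le_of_norm_le (i1.const_mul |u|) (ae_of_all _ fun ω => ?_)).trans ?_
  · have e : Complex.exp (((u * S ω : ℝ) : ℂ) * Complex.I) -
        Complex.exp (((u * T ω : ℝ) : ℂ) * Complex.I) =
        Complex.exp (((u * T ω : ℝ) : ℂ) * Complex.I) *
          (Complex.exp (Complex.I * ((u * (S ω - T ω) : ℝ) : ℂ)) - 1) := by
      rw [mul_sub, ← Complex.exp_add, mul_one]
      congr 2
      push_cast
      ring
    rw [e, norm_mul, Complex.norm_exp_ofReal_mul_I, one_mul, ← abs_mul]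
    exact Real.norm_exp_I_mul_ofReal_sub_one_le
  · rw [integral_const_mul]
    exact mul_le_mul_of_nonneg_left hsq (abs_nonneg u)

end CharFunEstimates

/-! ### Limits of powers -/

section Limits

theorem norm_pow_sub_pow_le_mul {x y : ℂ} (hx : ‖x‖ ≤ 1) (hy : ‖y‖ ≤ 1) (K : ℕ) :
    ‖x ^ K - y ^ K‖ ≤ K * ‖x - y‖ := by
  induction K with
  | zero => simp
  | succ K ih =>
    have e : x ^ (K + 1) - y ^ (K + 1) = x ^ K * (x - y) + (x ^ K - y ^ K) * y := by ring
    rw [e]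
    refine (norm_add_le _ _).trans ?_
    rw [norm_mul, norm_mul, norm_pow]
    have h1 : ‖x‖ ^ K * ‖x - y‖ ≤ ‖x - y‖ :=
      mul_le_of_le_one_left (norm_nonneg _) (pow_le_one₀ (norm_nonneg _) hx)
    have h2 : ‖x ^ K - y ^ K‖ * ‖y‖ ≤ ‖x ^ K - y ^ K‖ :=
      mul_le_of_le_one_right (norm_nonneg _) hy
    push_cast
    linarith

/-- Both φ and e^{-v/2} lie in the unit disc, so their K-th powers differ by at most K |φ -
e^{-v/2}|. Replacing 1 - v/2 by e^{-v/2} costs at most K v², which vanishes since K v converges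
while v → 0. -/
theorem tendsto_pow_exp_of_tendsto {φ : ℕ → ℂ} {v : ℕ → ℝ} {K : ℕ → ℕ} {s : ℝ}
    (hφ : ∀ n, ‖φ n‖ ≤ 1) (hv : ∀ n, 0 ≤ v n) (hK : Tendsto K atTop atTop)
    (hKv : Tendsto (fun n => (K n : ℝ) * v n) atTop (𝓝 s))
    (herr : Tendsto (fun n => (K n : ℝ) * ‖φ n - (1 - (v n : ℂ) / 2)‖) atTop (𝓝 0)) :
    Tendsto (fun n => φ n ^ K n) atTop (𝓝 (Complex.exp (-(s / 2 : ℝ)))) := by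
  have hKr : Tendsto (fun n => (K n : ℝ)) atTop atTop := tendsto_natCast_atTop_atTop.comp hK
  have hKinv : Tendsto (fun n => ((K n : ℝ))⁻¹) atTop (𝓝 0) := tendsto_inv_atTop_zero.comp hKr
  have hv0 : Tendsto v atTop (𝓝 0) := by
    have := hKv.mul hKinv
    rw [mul_zero] at this
    refine this.congr' ?_
    filter_upwards [hKr.eventually_gt_atTop 0] with n hn
    field_simp
  have hKv2 : Tendsto (fun n => (K n : ℝ) * v n ^ 2) atTop (𝓝 0) := by
    have := hKv.mul hv0
    rw [mul_zero] at this
    exact this.congr fun n => by ring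
  set e : ℕ → ℂ := fun n => Complex.exp (-(v n / 2 : ℝ)) with he
  have heK : Tendsto (fun n => e n ^ K n) atTop (𝓝 (Complex.exp (-(s / 2 : ℝ)))) := by
    have h1 : Tendsto (fun n => Complex.exp (-((K n : ℝ) * v n / 2 : ℝ))) atTop
        (𝓝 (Complex.exp (-(s / 2 : ℝ)))) :=
      (Complex.continuous_exp.tendsto _).comp
        ((Complex.continuous_ofReal.tendsto _).comp (hKv.div_const 2)).neg
    refine h1.congr fun n => ?_
    rw [he, ← Complex.exp_nat_mul]
    congr 1
    push_cast
    ring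
  have hnorm_e : ∀ n, ‖e n‖ ≤ 1 := fun n => by
    simp only [he]
    rw [← Complex.ofReal_neg, Complex.norm_exp_ofReal, Real.exp_le_one_iff]
    linarith [hv n]
  have hdiff : Tendsto (fun n => φ n ^ K n - e n ^ K n) atTop (𝓝 0) := by
    have hb : Tendsto (fun n => (K n : ℝ) * ‖φ n - (1 - (v n : ℂ) / 2)‖ + (K n : ℝ) * v n ^ 2)
        atTop (𝓝 0) := by simpa using herr.add hKv2
    refine squeeze_zero_norm' ?_ hb
    filter_upwards [hv0.eventually_le_const one_pos] with n hn
    refine (norm_pow_sub_pow_le_mul (hφ n) (hnorm_e n) (K n)).trans ?_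
    rw [← mul_add]
    refine mul_le_mul_of_nonneg_left ?_ (Nat.cast_nonneg _)
    have h1 : ‖(1 - (v n : ℂ) / 2) - e n‖ ≤ v n ^ 2 := by
      have h2 : (1 - (v n : ℂ) / 2) - e n =
          ((-(Real.exp (-(v n / 2)) - 1 - -(v n / 2)) : ℝ) : ℂ) := by
        rw [he]; push_cast; ring
      rw [h2, Complex.norm_real, Real.norm_eq_abs, abs_neg]
      have h3 := Real.abs_exp_sub_one_sub_id_le (x := -(v n / 2)) (by
        rw [abs_neg, abs_of_nonneg (by linarith [hv n])]; linarith)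
      refine h3.trans ?_
      nlinarith [sq_nonneg (v n)]
    calc ‖φ n - e n‖ = ‖(φ n - (1 - (v n : ℂ) / 2)) + ((1 - (v n : ℂ) / 2) - e n)‖ := by
          congr 1; ring
      _ ≤ _ := (norm_add_le _ _).trans (by gcongr)
  have := hdiff.add heK
  simpa using this

theorem tendsto_zero_of_forall_le {b x y : ℕ → ℝ} {s : ℝ} (hb : ∀ n, 0 ≤ b n)
    (hx : Tendsto x atTop (𝓝 s)) (hy : Tendsto y atTop (𝓝 0))
    (h : ∀ δ : ℝ, 0 < δ → ∀ n, b n ≤ δ * x n + y n / δ) : Tendsto b atTop (𝓝 0) := by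
  rw [Metric.tendsto_nhds]
  intro ε hε
  obtain ⟨δ, hδ, hδs⟩ : ∃ δ : ℝ, 0 < δ ∧ δ * s < ε := by
    rcases le_or_gt s 0 with hs | hs
    · exact ⟨1, one_pos, by linarith⟩
    · refine ⟨ε / (2 * s), by positivity, ?_⟩
      field_simp
      norm_num
  have h1 : Tendsto (fun n => δ * x n + y n / δ) atTop (𝓝 (δ * s)) := by
    simpa using (hx.const_mul δ).add (hy.div_const δ)
  filter_upwards [h1.eventually_lt_const hδs] with n hn
  rw [Real.dist_eq, sub_zero, abs_of_nonneg (hb n)]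
  exact (h δ hδ n).trans_lt hn

end Limits

/-! ### Decoupling of separated blocks -/

section Decoupling

variable {Ω : Type*} [MeasurableSpace Ω] {P : Measure Ω} {d : ℕ}
  {X : ℤ → Ω → EuclideanSpace ℝ (Fin d)}

/-- The last block is peeled off: the product of the first K factors depends on times up to K m + 1
- r, the next factor on times from K m + 1 on. Each step costs one complex covariance bound at
distance `r`. -/
theorem norm_integral_prod_sub_pow_le [IsProbabilityMeasure P] (hX : ∀ t, Measurable (X t))
    {g : ℕ → Ω → ℂ} {φ : ℂ} {m r : ℕ} (hg1 : ∀ j ω, ‖g j ω‖ ≤ 1)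
    (hpast : ∀ j : ℕ, Measurable[sigmaAt X (Set.Iic (((j : ℤ) + 1) * m + 1 - r))] (g j))
    (hfut : ∀ j : ℕ, Measurable[sigmaAt X (Set.Ici ((j : ℤ) * m + 1))] (g j))
    (hφ : ∀ j, ∫ ω, g j ω ∂P = φ) (K : ℕ) :
    ‖∫ ω, ∏ j ∈ Finset.range K, g j ω ∂P - φ ^ K‖ ≤ K * (16 * alphaCoeff P X r) := by
  have hφ1 : ‖φ‖ ≤ 1 := by
    rw [← hφ 0]
    refine (norm_integral_le_of_norm_le_const (ae_of_all _ (hg1 0))).trans ?_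
    simp
  induction K with
  | zero => simp
  | succ K ih =>
    have hmono : ∀ {a b : ℤ}, a ≤ b → sigmaAt X (Set.Iic a) ≤ sigmaAt X (Set.Iic b) := fun hab =>
      biSup_mono fun t (ht : t ≤ _) => le_trans ht hab
    have hm1 : Measurable[sigmaAt X (Set.Iic ((K : ℤ) * m + 1 - r))]
        fun ω => ∏ j ∈ Finset.range K, g j ω := by
      refine Finset.measurable_fun_prod _ fun j hj => (hpast j).mono (hmono ?_) le_rfl
      have : ((j : ℤ) + 1) * m ≤ K * m := by
        have := Finset.mem_range.1 hj
        exact mul_le_mul_of_nonneg_right (by exact_mod_cast this) (Nat.cast_nonneg _)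
      linarith
    have hcov := (mixingBound_alphaCoeff (P := P) (X := X) ((K : ℤ) * m + 1 - r) r).norm_cov_le
      (sigmaAt_le hX _) (sigmaAt_le hX _) hm1
      (fun ω => by
        rw [norm_prod]; exact Finset.prod_le_one (fun _ _ => norm_nonneg _) fun j _ => hg1 j ω)
      (by rw [sub_add_cancel]; exact hfut K) (hg1 K)
    simp only [Finset.prod_range_succ]
    rw [hφ K] at hcov
    have e : ∫ ω, (∏ j ∈ Finset.range K, g j ω) * g K ω ∂P - φ ^ (K + 1) =
        (∫ ω, (∏ j ∈ Finset.range K, g j ω) * g K ω ∂P -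
          (∫ ω, ∏ j ∈ Finset.range K, g j ω ∂P) * φ) +
        (∫ ω, ∏ j ∈ Finset.range K, g j ω ∂P - φ ^ K) * φ := by ring
    rw [e]
    refine (norm_add_le _ _).trans ?_
    rw [norm_mul]
    have h2 := mul_le_of_le_one_right
      (norm_nonneg (∫ ω, ∏ j ∈ Finset.range K, g j ω ∂P - φ ^ K)) hφ1
    push_cast
    linarith

end Decoupling

/-! ### Counting blocks and leftover times -/

section BlockCounts

variable {m r : ℕ → ℕ}

theorem eventually_pos_of_ratio (hm : Tendsto m atTop atTop) :
    ∀ᶠ n in atTop, (0 : ℝ) < m n ∧ (0 : ℝ) < n := by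
  filter_upwards [hm.eventually_gt_atTop 0, eventually_gt_atTop 0] with n h1 h2
  exact ⟨by exact_mod_cast h1, by exact_mod_cast h2⟩

theorem tendsto_blocks_mul (hm : Tendsto m atTop atTop)
    (hmn : Tendsto (fun n : ℕ => (m n : ℝ) / n) atTop (𝓝 0)) :
    Tendsto (fun n : ℕ => ((n / m n : ℕ) : ℝ) * (m n / n)) atTop (𝓝 1) := by
  have h1 : Tendsto (fun n : ℕ => 1 - (m n : ℝ) / n) atTop (𝓝 1) := by
    simpa using hmn.const_sub 1
  refine tendsto_of_tendsto_of_tendsto_of_le_of_le' h1 tendsto_const_nhds ?_ ?_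
  · filter_upwards [eventually_pos_of_ratio hm] with n hn
    obtain ⟨hn1, hn2⟩ := hn
    have h2 : n < (n / m n + 1) * m n :=
      Nat.lt_mul_of_div_lt (Nat.lt_succ_self _) (by exact_mod_cast hn1)
    have h3 : (n : ℝ) ≤ (((n / m n : ℕ) : ℝ) + 1) * m n := by exact_mod_cast h2.le
    rw [one_sub_div hn2.ne', mul_div_assoc', div_le_div_iff_of_pos_right hn2]
    linarith
  · filter_upwards [eventually_pos_of_ratio hm] with n hn
    obtain ⟨hn1, hn2⟩ := hn
    have h2 : ((n / m n : ℕ) : ℝ) * m n ≤ n := by exact_mod_cast Nat.div_mul_le_self n (m n)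
    rw [mul_div_assoc', div_le_one hn2]
    exact h2

theorem tendsto_blocks (hm : Tendsto m atTop atTop)
    (hmn : Tendsto (fun n : ℕ => (m n : ℝ) / n) atTop (𝓝 0)) :
    Tendsto (fun n : ℕ => n / m n) atTop atTop := by
  rw [← tendsto_natCast_atTop_iff (R := ℝ)]
  have hpos : ∀ᶠ n in atTop, (m n : ℝ) / n ∈ Set.Ioi (0 : ℝ) := by
    filter_upwards [eventually_pos_of_ratio hm] with n hn using div_pos hn.1 hn.2
  have h1 : Tendsto (fun n : ℕ => ((m n : ℝ) / n)⁻¹) atTop atTop :=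
    tendsto_inv_nhdsGT_zero.comp (tendsto_nhdsWithin_iff.2 ⟨hmn, hpos⟩)
  refine ((tendsto_blocks_mul hm hmn).pos_mul_atTop one_pos h1).congr' ?_
  filter_upwards [eventually_pos_of_ratio hm] with n hn
  have := hn.1.ne'
  have := hn.2.ne'
  field_simp

theorem tendsto_blockLength_div (hm : Tendsto m atTop atTop)
    (hrm : Tendsto (fun n : ℕ => (r n : ℝ) / m n) atTop (𝓝 0)) :
    (∀ᶠ n in atTop, r n ≤ m n) ∧
      Tendsto (fun n : ℕ => ((m n - r n : ℕ) : ℝ) / m n) atTop (𝓝 1) := by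
  have hle : ∀ᶠ n in atTop, r n ≤ m n := by
    filter_upwards [hrm.eventually_lt_const one_pos, hm.eventually_gt_atTop 0] with n h1 h2
    rw [div_lt_one (by exact_mod_cast h2)] at h1
    exact_mod_cast h1.le
  refine ⟨hle, ?_⟩
  have h1 : Tendsto (fun n : ℕ => 1 - (r n : ℝ) / m n) atTop (𝓝 1) := by
    simpa using hrm.const_sub 1
  refine h1.congr' ?_
  filter_upwards [hle, hm.eventually_gt_atTop 0] with n h1 h2
  have : (m n : ℝ) ≠ 0 := by positivity
  rw [Nat.cast_sub h1, sub_div, div_self this]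

theorem tendsto_blockLength (hm : Tendsto m atTop atTop)
    (hrm : Tendsto (fun n : ℕ => (r n : ℝ) / m n) atTop (𝓝 0)) :
    Tendsto (fun n : ℕ => m n - r n) atTop atTop := by
  rw [← tendsto_natCast_atTop_iff (R := ℝ)]
  refine ((tendsto_blockLength_div hm hrm).2.pos_mul_atTop one_pos
    (tendsto_natCast_atTop_atTop.comp hm)).congr' ?_
  filter_upwards [hm.eventually_gt_atTop 0] with n h2
  have : (m n : ℝ) ≠ 0 := by positivity
  simp only [Function.comp_apply]
  field_simp

/-- Each block is the initial stretch of length `L` of a window of length `m`; `T` consists of the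
times from 1 to `n` outside all blocks. -/
theorem exists_remainder {n m L K : ℕ} (hLm : L ≤ m) (hK : K * m ≤ n) :
    ∃ T : Finset ℕ, T ⊆ Finset.range (n + 1) ∧ T.card = n - K * L ∧ ∀ y : ℕ → ℝ,
      ∑ t ∈ Finset.Icc 1 n, y t -
        ∑ j ∈ Finset.range K, ∑ i ∈ Finset.range L, y (j * m + 1 + i) = ∑ t ∈ T, y t := by
  set e : ℕ × ℕ → ℕ := fun x => x.1 * m + 1 + x.2 with he
  have hinj : Set.InjOn e (Finset.range K ×ˢ Finset.range L : Finset (ℕ × ℕ)) := by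
    rintro ⟨j, i⟩ hx ⟨j', i'⟩ hx' h
    simp only [Finset.coe_product, Set.mem_prod, Finset.mem_coe, Finset.mem_range] at hx hx'
    -- The existence of an index i < L forces 0 < L ≤ m.
    have hm0 : 0 < m := by omega
    have h1 : j * m + i = j' * m + i' := by simp only [he] at h; omega
    have h2 : ∀ a b : ℕ, b < L → (a * m + b) / m = a := fun a b hb => by
      rw [mul_comm, Nat.mul_add_div hm0, Nat.div_eq_of_lt (by omega), add_zero]
    have h3 : j = j' := by rw [← h2 j i hx.2, h1, h2 j' i' hx'.2]
    subst h3
    simp only [Prod.mk.injEq, true_and]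
    omega
  set B := (Finset.range K ×ˢ Finset.range L).image e with hB
  have hsub : B ⊆ Finset.Icc 1 n := by
    intro t ht
    obtain ⟨⟨j, i⟩, hx, rfl⟩ := Finset.mem_image.1 ht
    simp only [Finset.mem_product, Finset.mem_range] at hx
    have : (j + 1) * m ≤ K * m := Nat.mul_le_mul_right m hx.1
    simp only [he, Finset.mem_Icc]
    constructor
    · omega
    · linarith
  refine ⟨Finset.Icc 1 n \ B, ?_, ?_, fun y => ?_⟩
  · intro t ht
    have := Finset.mem_Icc.1 (Finset.mem_sdiff.1 ht).1
    exact Finset.mem_range.2 (by omega)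
  · rw [Finset.card_sdiff_of_subset hsub, hB, Finset.card_image_of_injOn hinj,
      Finset.card_product, Finset.card_range, Finset.card_range, Nat.card_Icc,
      Nat.add_sub_cancel]
  · rw [← Finset.sum_sdiff hsub, hB, Finset.sum_image hinj, Finset.sum_product]
    simp [he]

end BlockCounts

/-! ### From the full sum to independent blocks -/

section Blocks

variable {Ω : Type*} [MeasurableSpace Ω] {P : Measure Ω} {d : ℕ}
  {X : ℤ → Ω → EuclideanSpace ℝ (Fin d)} {D : Set (EuclideanSpace ℝ (Fin d))}

theorem measurable_sum_centred (hX : ∀ t, Measurable (X t)) (hD : MeasurableSet D)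
    (T : Finset ℕ) : Measurable fun ω => ∑ t ∈ T, centred P X D t ω :=
  Finset.measurable_fun_sum _ fun t _ => measurable_centred hX hD t

theorem abs_sum_centred_le [IsProbabilityMeasure P] (T : Finset ℕ) (ω : Ω) :
    |∑ t ∈ T, centred P X D t ω| ≤ T.card := by
  refine (Finset.abs_sum_le_sum_abs _ _).trans ?_
  refine (Finset.sum_le_card_nsmul _ _ 1 fun t _ => abs_centred_le _ ω).trans_eq ?_
  simp

theorem integral_exp_block_shift [IsProbabilityMeasure P]
    (hstat : StrictlyStationary P X) (hD : MeasurableSet D) (c : ℝ) (L k : ℕ) :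
    ∫ ω, Complex.exp (((c * ∑ i ∈ Finset.range L, centred P X D ((k + i : ℕ) : ℤ) ω : ℝ) : ℂ) *
      Complex.I) ∂P =
    ∫ ω, Complex.exp (((c * ∑ i ∈ Finset.range L, centred P X D (i : ℤ) ω : ℝ) : ℂ) *
      Complex.I) ∂P := by
  have hf : Measurable fun x : ℤ → EuclideanSpace ℝ (Fin d) =>
      Complex.exp (((c * ∑ i ∈ Finset.range L, (D.indicator (fun _ => (1 : ℝ)) (x (i : ℤ)) -
        P.real (X 0 ⁻¹' D)) : ℝ) : ℂ) * Complex.I) := by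
    have h1 : ∀ i : ℕ, Measurable fun x : ℤ → EuclideanSpace ℝ (Fin d) =>
        D.indicator (fun _ => (1 : ℝ)) (x (i : ℤ)) := fun i =>
      (measurable_const.indicator hD).comp (measurable_pi_apply _)
    fun_prop
  have := hstat.integral_eq (k : ℤ) hf
  simp only [centred]
  rw [← this]
  simp only [Nat.cast_add, add_comm]

/-- Comparison of the characteristic function of the full sum with that of independent blocks. -/
theorem norm_charFun_sub_pow_le [IsProbabilityMeasure P] (hX : ∀ t, Measurable (X t))
    (hstat : StrictlyStationary P X) (hD : MeasurableSet D) {n m r : ℕ} (hr : r ≤ m) (u : ℝ) :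
    ‖∫ ω, Complex.exp (((u * (√((m : ℝ) / n) * ∑ t ∈ Finset.Icc 1 n, centred P X D t ω) : ℝ) : ℂ) *
        Complex.I) ∂P -
      (∫ ω, Complex.exp (((u * √((m : ℝ) / n) * ∑ t ∈ Finset.range (m - r),
        centred P X D t ω : ℝ) : ℂ) * Complex.I) ∂P) ^ (n / m)‖ ≤
    |u| * √((m : ℝ) / n * ((n - n / m * (m - r) : ℕ) *
      (2 * ∑ h ∈ Finset.range (n + 1), |lagCov P X D h|))) +
    (n / m : ℕ) * (16 * alphaCoeff P X r) := by
  set K := n / m with hK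
  set L := m - r with hL
  set c := √((m : ℝ) / n) with hc
  obtain ⟨T, hT, hTc, hTs⟩ := exists_remainder (n := n) (m := m) (L := L) (K := K)
    (Nat.sub_le _ _) (Nat.div_mul_le_self n m)
  set Y : ℕ → Ω → ℝ := fun t ω => centred P X D t ω with hY
  have hYm : ∀ t, Measurable (Y t) := fun t => measurable_centred hX hD t
  have hSm : Measurable fun ω => c * ∑ t ∈ Finset.Icc 1 n, Y t ω :=
    (measurable_sum_centred hX hD _).const_mul c
  have hBm : Measurable fun ω => c * ∑ j ∈ Finset.range K, ∑ i ∈ Finset.range L,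
      Y (j * m + 1 + i) ω := by fun_prop
  have hdiff : ∀ ω, c * ∑ t ∈ Finset.Icc 1 n, Y t ω - c * ∑ j ∈ Finset.range K,
      ∑ i ∈ Finset.range L, Y (j * m + 1 + i) ω = c * ∑ t ∈ T, Y t ω := fun ω => by
    rw [← mul_sub, hTs fun t => Y t ω]
  have hb : ∀ ω, |c * ∑ t ∈ Finset.Icc 1 n, Y t ω - c * ∑ j ∈ Finset.range K,
      ∑ i ∈ Finset.range L, Y (j * m + 1 + i) ω| ≤ c * T.card := fun ω => by
    rw [hdiff, abs_mul, abs_of_nonneg (Real.sqrt_nonneg _)]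
    exact mul_le_mul_of_nonneg_left (abs_sum_centred_le T ω) (Real.sqrt_nonneg _)
  -- Discarding the leftover times costs the L² norm of their normalised sum, estimated in `h2`.
  have h1 := norm_integral_exp_sub_integral_exp_le (P := P) hSm hBm hb u
  have h2 : ∫ ω, (c * ∑ t ∈ Finset.Icc 1 n, Y t ω - c * ∑ j ∈ Finset.range K,
      ∑ i ∈ Finset.range L, Y (j * m + 1 + i) ω) ^ 2 ∂P ≤
      (m : ℝ) / n * ((n - K * L : ℕ) * (2 * ∑ h ∈ Finset.range (n + 1), |lagCov P X D h|)) := by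
    simp only [hdiff, mul_pow]
    rw [integral_const_mul, hc, Real.sq_sqrt (by positivity), ← hTc]
    exact mul_le_mul_of_nonneg_left (integral_sq_sum_centred_le hX hstat hD hT) (by positivity)
  -- Block j uses the times j m + 1 to (j + 1) m - r, so the required distance `r` to the next block
  -- holds with one time to spare.
  have h3 := norm_integral_prod_sub_pow_le (P := P) hX (m := m) (r := r)
    (g := fun j ω => Complex.exp (((u * c * ∑ i ∈ Finset.range L,
      centred P X D ((j * m + 1 + i : ℕ) : ℤ) ω : ℝ) : ℂ) * Complex.I))
    (fun j ω => (Complex.norm_exp_ofReal_mul_I _).le)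
    (fun j => by
      refine Complex.measurable_exp.comp ((Complex.measurable_ofReal.comp
        ((Finset.measurable_fun_sum _ fun i hi => measurable_centred_sigmaAt hD ?_).const_mul
          _)).mul_const _)
      have := Finset.mem_range.1 hi
      rw [Set.mem_Iic]
      push_cast
      have h5 : (i : ℤ) + r ≤ m := by omega
      linarith)
    (fun j => by
      refine Complex.measurable_exp.comp ((Complex.measurable_ofReal.comp
        ((Finset.measurable_fun_sum _ fun i hi => measurable_centred_sigmaAt hD ?_).const_mul
          _)).mul_const _)
      rw [Set.mem_Ici]
      push_cast
      linarith [Int.natCast_nonneg i])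
    (fun j => integral_exp_block_shift hstat hD (u * c) L (j * m + 1)) K
  have h4 : ∀ ω, ∏ j ∈ Finset.range K, Complex.exp (((u * c * ∑ i ∈ Finset.range L,
      centred P X D ((j * m + 1 + i : ℕ) : ℤ) ω : ℝ) : ℂ) * Complex.I) =
      Complex.exp (((u * (c * ∑ j ∈ Finset.range K, ∑ i ∈ Finset.range L,
        Y (j * m + 1 + i) ω) : ℝ) : ℂ) * Complex.I) := fun ω => by
    rw [← Complex.exp_sum, ← Finset.sum_mul, ← Complex.ofReal_sum, ← Finset.mul_sum, mul_assoc u c]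
  simp only [h4] at h3
  refine (norm_sub_le_norm_sub_add_norm_sub _ _ _).trans (add_le_add (h1.trans ?_) h3)
  exact mul_le_mul_of_nonneg_left (Real.sqrt_le_sqrt h2) (abs_nonneg u)

end Blocks

/-! ### Limit theorem for the array of rare-event indicators -/

section ArrayLimit

variable {Ω : Type*} [MeasurableSpace Ω] {P : Measure Ω} [IsProbabilityMeasure P] {d : ℕ}
  {X : ℤ → Ω → EuclideanSpace ℝ (Fin d)} {D : ℕ → Set (EuclideanSpace ℝ (Fin d))}
  {m r : ℕ → ℕ} {τ : ℕ → ℝ} {q : ℝ}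

theorem tendsto_block_variance (hX : ∀ t, Measurable (X t)) (hstat : StrictlyStationary P X)
    (hD : ∀ n, MeasurableSet (D n)) (hm : Tendsto m atTop atTop)
    (hrm : Tendsto (fun n : ℕ => (r n : ℝ) / m n) atTop (𝓝 0))
    (hlim : ∀ h, Tendsto (fun n => (m n : ℝ) * lagCov P X (D n) h) atTop (𝓝 (τ h)))
    (htail : ∀ ε : ℝ, 0 < ε → ∃ k, ∀ᶠ n in atTop, ∀ N, ∑ h ∈ Finset.Ico k N,
      |(m n : ℝ) * lagCov P X (D n) h| ≤ ε) :
    Tendsto (fun n => ∫ ω, (∑ t ∈ Finset.range (m n - r n), centred P X (D n) t ω) ^ 2 ∂P) atTop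
      (𝓝 (∑' h, lagWeight h * τ h)) := by
  obtain ⟨-, hLm⟩ := tendsto_blockLength_div hm hrm
  have hL := tendsto_blockLength hm hrm
  set L : ℕ → ℕ := fun n => m n - r n with hLdef
  -- Truncated subtraction keeps this factor in [0, 1] even at lags longer than the block, so the
  -- tail bound applies at every lag.
  set u : ℕ → ℕ → ℝ := fun n h => ((L n - h : ℕ) : ℝ) / m n *
    (lagWeight h * ((m n : ℝ) * lagCov P X (D n) h)) with hu
  have hulim : ∀ h, Tendsto (fun n => u n h) atTop (𝓝 (lagWeight h * τ h)) := fun h => by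
    have h1 : Tendsto (fun n => ((L n - h : ℕ) : ℝ) / m n) atTop (𝓝 1) := by
      have h2 : Tendsto (fun n => (h : ℝ) / m n) atTop (𝓝 0) :=
        tendsto_const_nhds.div_atTop (tendsto_natCast_atTop_atTop.comp hm)
      have h3 := hLm.sub h2
      rw [sub_zero] at h3
      refine h3.congr' ?_
      filter_upwards [hL.eventually_ge_atTop h] with n hn
      rw [Nat.cast_sub hn, sub_div]
    simpa using h1.mul ((hlim h).const_mul (lagWeight h))
  have hule : ∀ n h, |u n h| ≤ 2 * |(m n : ℝ) * lagCov P X (D n) h| := fun n h => by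
    have h1 : ((L n - h : ℕ) : ℝ) / m n ≤ 1 :=
      div_le_one_of_le₀ (by exact_mod_cast (Nat.sub_le _ _).trans (Nat.sub_le _ _))
        (Nat.cast_nonneg _)
    simp only [hu]
    rw [abs_mul, abs_mul, abs_of_nonneg (lagWeight_nonneg h),
      abs_of_nonneg (a := ((L n - h : ℕ) : ℝ) / m n) (by positivity)]
    refine (mul_le_of_le_one_left (mul_nonneg (lagWeight_nonneg h) (abs_nonneg _)) h1).trans ?_
    exact mul_le_mul_of_nonneg_right (lagWeight_le h) (abs_nonneg _)
  have hutail : ∀ ε : ℝ, 0 < ε → ∃ k, ∀ᶠ n in atTop, ∀ N, ∑ h ∈ Finset.Ico k N, |u n h| ≤ ε := by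
    intro ε hε
    obtain ⟨k, hk⟩ := htail (ε / 2) (by positivity)
    refine ⟨k, hk.mono fun n hn N => (Finset.sum_le_sum fun h _ => hule n h).trans ?_⟩
    rw [← Finset.mul_sum]
    linarith [hn N]
  refine (tendsto_sum_range_of_tail hulim hutail hL).congr' ?_
  filter_upwards [hm.eventually_gt_atTop 0] with n hn
  rw [integral_sq_block hX hstat (hD n)]
  refine Finset.sum_congr rfl fun h hh => ?_
  have hn' : (m n : ℝ) ≠ 0 := by positivity
  simp only [hu]
  rw [Nat.cast_sub (Finset.mem_range.1 hh).le]
  field_simp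

/-- This is the Lyapunov condition. In the first alternative S⁴ ≤ m² S² and the second moment of the
block is bounded, which leaves O(m³/n). In the second, the terms of `integral_pow_four_block_le`,
once scaled, are of order (m p)(m r³/n), (m⁴/n) ∑ α_j and m/n. -/
theorem tendsto_block_fourth_moment (hX : ∀ t, Measurable (X t)) (hstat : StrictlyStationary P X)
    (hD : ∀ n, MeasurableSet (D n)) (hm : Tendsto m atTop atTop)
    (hmn : Tendsto (fun n : ℕ => (m n : ℝ) / n) atTop (𝓝 0))
    (hp : Tendsto (fun n => (m n : ℝ) * P.real (X 0 ⁻¹' D n)) atTop (𝓝 q))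
    (hlim : ∀ h, Tendsto (fun n => (m n : ℝ) * lagCov P X (D n) h) atTop (𝓝 (τ h)))
    (htail : ∀ ε : ℝ, 0 < ε → ∃ k, ∀ᶠ n in atTop, ∀ N, ∑ h ∈ Finset.Ico k N,
      |(m n : ℝ) * lagCov P X (D n) h| ≤ ε)
    (hgrowth :
      ((fun n : ℕ => (m n : ℝ)) =o[atTop] fun n : ℕ => (n : ℝ) ^ (1 / 3 : ℝ)) ∨
      (Tendsto (fun n : ℕ => (m n : ℝ) ^ 4 / n * ∑ j ∈ Finset.Icc (r n) (m n), alphaCoeff P X j)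
          atTop (𝓝 0) ∧
        Tendsto (fun n : ℕ => (m n : ℝ) * (r n : ℝ) ^ 3 / n) atTop (𝓝 0))) :
    Tendsto (fun n => (m n : ℝ) / n *
      ∫ ω, (∑ t ∈ Finset.range (m n - r n), centred P X (D n) t ω) ^ 4 ∂P) atTop (𝓝 0) := by
  obtain ⟨K₀, hK₀, hK⟩ := eventually_sum_range_abs_le hlim htail
  have hpos := eventually_pos_of_ratio hm
  have hLc : ∀ n, ((m n - r n : ℕ) : ℝ) ≤ m n := fun n => by exact_mod_cast Nat.sub_le _ _
  have hsum : ∀ n N, ∑ h ∈ Finset.range N, |(m n : ℝ) * lagCov P X (D n) h| =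
      m n * ∑ h ∈ Finset.range N, |lagCov P X (D n) h| := fun n N => by
    rw [Finset.mul_sum]
    exact Finset.sum_congr rfl fun h _ => by rw [abs_mul, abs_of_nonneg (Nat.cast_nonneg _)]
  have hLK : ∀ᶠ n in atTop, ((m n - r n : ℕ) : ℝ) *
      (2 * ∑ h ∈ Finset.range (m n - r n), |lagCov P X (D n) h|) ≤ 2 * K₀ := by
    filter_upwards [hK] with n hn
    have h1 := hn (m n - r n)
    rw [hsum] at h1
    have h2 : 0 ≤ ∑ h ∈ Finset.range (m n - r n), |lagCov P X (D n) h| :=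
      Finset.sum_nonneg fun _ _ => abs_nonneg _
    have h3 := mul_le_mul_of_nonneg_right (hLc n) h2
    linarith
  have hnonneg : ∀ n, 0 ≤ (m n : ℝ) / n *
      ∫ ω, (∑ t ∈ Finset.range (m n - r n), centred P X (D n) t ω) ^ 4 ∂P := fun n =>
    mul_nonneg (by positivity) (integral_nonneg fun ω => by positivity)
  rcases hgrowth with hg | ⟨hg1, hg2⟩
  · have hcube : Tendsto (fun n : ℕ => (m n : ℝ) ^ 3 / n) atTop (𝓝 0) := by
      refine ((hg.pow (n := 3) (by norm_num)).tendsto_div_nhds_zero).congr fun n => ?_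
      rw [← Real.rpow_natCast ((n : ℝ) ^ (1 / 3 : ℝ)), ← Real.rpow_mul (Nat.cast_nonneg _)]
      norm_num
    have hbd : Tendsto (fun n : ℕ => (m n : ℝ) ^ 3 / n * (2 * K₀)) atTop (𝓝 0) := by
      simpa using hcube.mul_const (2 * K₀)
    refine squeeze_zero' (Eventually.of_forall hnonneg) ?_ hbd
    filter_upwards [hLK] with n hn
    have hsm : Measurable fun ω => ∑ t ∈ Finset.range (m n - r n), centred P X (D n) t ω :=
      measurable_sum_centred hX (hD n) _
    have hsb : ∀ ω, |∑ t ∈ Finset.range (m n - r n), centred P X (D n) t ω| ≤ m n := fun ω =>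
      (abs_sum_centred_le _ ω).trans (by rw [Finset.card_range]; exact hLc n)
    have h4 : ∫ ω, (∑ t ∈ Finset.range (m n - r n), centred P X (D n) t ω) ^ 4 ∂P ≤
        (m n : ℝ) ^ 2 * (2 * K₀) := by
      calc _ ≤ ∫ ω, (m n : ℝ) ^ 2 *
            (∑ t ∈ Finset.range (m n - r n), centred P X (D n) t ω) ^ 2 ∂P := by
            refine integral_mono (integrable_pow_of_abs_le hsm hsb 4)
              ((integrable_pow_of_abs_le hsm hsb 2).const_mul _) fun ω => ?_
            have h5 := sq_le_sq' (by linarith [(abs_le.1 (hsb ω)).1]) (abs_le.1 (hsb ω)).2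
            have h6 := mul_le_mul_of_nonneg_right h5
              (sq_nonneg (∑ t ∈ Finset.range (m n - r n), centred P X (D n) t ω))
            simp only
            linarith
        _ ≤ _ := by
            rw [integral_const_mul]
            refine mul_le_mul_of_nonneg_left ?_ (by positivity)
            refine (integral_sq_sum_centred_le hX hstat (hD n) (Finset.Subset.refl _)).trans ?_
            rw [Finset.card_range]
            exact hn
    refine (mul_le_mul_of_nonneg_left h4 (by positivity)).trans_eq ?_
    ring
  · have hbd : Tendsto (fun n : ℕ => 24 * (2 * ((m n : ℝ) * P.real (X 0 ⁻¹' D n)) *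
        ((m n : ℝ) * (r n : ℝ) ^ 3 / n) +
        24 * ((m n : ℝ) ^ 4 / n * ∑ j ∈ Finset.Icc (r n) (m n), alphaCoeff P X j) +
        (m n : ℝ) / n * (2 * K₀) ^ 2)) atTop (𝓝 0) := by
      have := (((((hp.const_mul 2).mul hg2).add (hg1.const_mul 24)).add
        (hmn.mul_const ((2 * K₀) ^ 2))).const_mul 24)
      simpa using this
    refine squeeze_zero' (Eventually.of_forall hnonneg) ?_ hbd
    filter_upwards [hLK, hpos] with n hn hn0
    have h1 := integral_pow_four_block_le (P := P) hX hstat (hD n) (m n - r n) (r n)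
    have hS0 : 0 ≤ ∑ h ∈ Finset.range (m n - r n), |lagCov P X (D n) h| :=
      Finset.sum_nonneg fun _ _ => abs_nonneg _
    have hα : ∑ h ∈ Finset.Ico (r n) (m n - r n), alphaCoeff P X h ≤
        ∑ j ∈ Finset.Icc (r n) (m n), alphaCoeff P X j := by
      refine Finset.sum_le_sum_of_subset_of_nonneg (fun h hh => ?_) fun h _ _ => alphaCoeff_nonneg h
      simp only [Finset.mem_Ico, Finset.mem_Icc] at hh ⊢
      omega
    have hα0 : 0 ≤ ∑ h ∈ Finset.Ico (r n) (m n - r n), alphaCoeff P X h :=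
      Finset.sum_nonneg fun h _ => alphaCoeff_nonneg h
    have hp0 : 0 ≤ P.real (X 0 ⁻¹' D n) := measureReal_nonneg
    have h2 : 24 * (2 * P.real (X 0 ⁻¹' D n) * (((m n - r n : ℕ) : ℝ) * (r n : ℝ) ^ 3) +
        24 * (((m n - r n : ℕ) : ℝ) ^ 3 *
          ∑ h ∈ Finset.Ico (r n) (m n - r n), alphaCoeff P X h) +
        (((m n - r n : ℕ) : ℝ) *
          (2 * ∑ h ∈ Finset.range (m n - r n), |lagCov P X (D n) h|)) ^ 2) ≤
        24 * (2 * P.real (X 0 ⁻¹' D n) * ((m n : ℝ) * (r n : ℝ) ^ 3) +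
        24 * ((m n : ℝ) ^ 3 * ∑ j ∈ Finset.Icc (r n) (m n), alphaCoeff P X j) +
        (2 * K₀) ^ 2) := by
      have := hLc n
      gcongr
    refine (mul_le_mul_of_nonneg_left (h1.trans h2) (by positivity)).trans_eq ?_
    obtain ⟨ha, hb⟩ := hn0
    field_simp

/-- Central limit theorem, in terms of characteristic functions, for the centred indicators of
rare events. -/
theorem tendsto_charFun_array (hX : ∀ t, Measurable (X t)) (hstat : StrictlyStationary P X)
    (hD : ∀ n, MeasurableSet (D n)) (hm : Tendsto m atTop atTop)
    (hmn : Tendsto (fun n : ℕ => (m n : ℝ) / n) atTop (𝓝 0))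
    (hrm : Tendsto (fun n : ℕ => (r n : ℝ) / m n) atTop (𝓝 0))
    (hkr : Tendsto (fun n : ℕ => (n : ℝ) / m n * alphaCoeff P X (r n)) atTop (𝓝 0))
    (hp : Tendsto (fun n => (m n : ℝ) * P.real (X 0 ⁻¹' D n)) atTop (𝓝 q))
    (hlim : ∀ h, Tendsto (fun n => (m n : ℝ) * lagCov P X (D n) h) atTop (𝓝 (τ h)))
    (htail : ∀ ε : ℝ, 0 < ε → ∃ k, ∀ᶠ n in atTop, ∀ N, ∑ h ∈ Finset.Ico k N,
      |(m n : ℝ) * lagCov P X (D n) h| ≤ ε)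
    (hgrowth :
      ((fun n : ℕ => (m n : ℝ)) =o[atTop] fun n : ℕ => (n : ℝ) ^ (1 / 3 : ℝ)) ∨
      (Tendsto (fun n : ℕ => (m n : ℝ) ^ 4 / n * ∑ j ∈ Finset.Icc (r n) (m n), alphaCoeff P X j)
          atTop (𝓝 0) ∧
        Tendsto (fun n : ℕ => (m n : ℝ) * (r n : ℝ) ^ 3 / n) atTop (𝓝 0))) (u : ℝ) :
    Tendsto (fun n : ℕ => ∫ ω, Complex.exp (((u * (√((m n : ℝ) / n) *
      ∑ t ∈ Finset.Icc 1 n, centred P X (D n) t ω) : ℝ) : ℂ) * Complex.I) ∂P) atTop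
      (𝓝 (Complex.exp (-(u ^ 2 * (∑' h, lagWeight h * τ h) / 2 : ℝ)))) := by
  obtain ⟨K₀, hK₀, hK⟩ := eventually_sum_range_abs_le hlim htail
  have hpos := eventually_pos_of_ratio hm
  obtain ⟨hle, hLm⟩ := tendsto_blockLength_div hm hrm
  have hKm := tendsto_blocks_mul hm hmn
  have hKtop := tendsto_blocks hm hmn
  have hB2 := tendsto_block_variance hX hstat hD hm hrm hlim htail
  have hB4 := tendsto_block_fourth_moment hX hstat hD hm hmn hp hlim htail hgrowth
  set s := ∑' h, lagWeight h * τ h with hs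
  set Z : ℕ → Ω → ℝ := fun n ω => u * √((m n : ℝ) / n) *
    ∑ t ∈ Finset.range (m n - r n), centred P X (D n) t ω with hZ
  set φ : ℕ → ℂ := fun n => ∫ ω, Complex.exp ((Z n ω : ℂ) * Complex.I) ∂P with hφ
  have hZm : ∀ n, Measurable (Z n) := fun n => (measurable_sum_centred hX (hD n) _).const_mul _
  have hZb : ∀ n ω, |Z n ω| ≤ |u * √((m n : ℝ) / n)| * (m n - r n : ℕ) := fun n ω => by
    rw [hZ, abs_mul]
    refine mul_le_mul_of_nonneg_left ((abs_sum_centred_le _ ω).trans_eq ?_) (abs_nonneg _)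
    rw [Finset.card_range]
  have hZ0 : ∀ n, ∫ ω, Z n ω ∂P = 0 := fun n => by
    simp only [hZ]
    rw [integral_const_mul, integral_finsetSum (Finset.range (m n - r n)) fun t _ =>
      integrable_centred (P := P) hX (hD n) t]
    simp [integral_centred hX hstat (hD n)]
  have hc2 : ∀ n : ℕ, (u * √((m n : ℝ) / n)) ^ 2 = u ^ 2 * ((m n : ℝ) / n) := fun n => by
    rw [mul_pow, Real.sq_sqrt (by positivity)]
  have hv : ∀ n, ∫ ω, Z n ω ^ 2 ∂P = u ^ 2 * ((m n : ℝ) / n) *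
      ∫ ω, (∑ t ∈ Finset.range (m n - r n), centred P X (D n) t ω) ^ 2 ∂P := fun n => by
    simp only [hZ, mul_pow _ _ 2, Real.sq_sqrt (show (0 : ℝ) ≤ (m n : ℝ) / n by positivity)]
    rw [integral_const_mul]
  have hv4 : ∀ n, ∫ ω, Z n ω ^ 4 ∂P = (u ^ 2 * ((m n : ℝ) / n)) ^ 2 *
      ∫ ω, (∑ t ∈ Finset.range (m n - r n), centred P X (D n) t ω) ^ 4 ∂P := fun n => by
    simp only [hZ, mul_pow (u * √((m n : ℝ) / n)) _ 4]
    rw [integral_const_mul, ← hc2]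
    ring
  have hKv : Tendsto (fun n : ℕ => ((n / m n : ℕ) : ℝ) * ∫ ω, Z n ω ^ 2 ∂P) atTop
      (𝓝 (u ^ 2 * s)) := by
    have := (hKm.mul hB2).const_mul (u ^ 2)
    rw [one_mul] at this
    refine this.congr fun n => ?_
    rw [hv]; ring
  have hKv4 : Tendsto (fun n : ℕ => ((n / m n : ℕ) : ℝ) * ∫ ω, Z n ω ^ 4 ∂P) atTop (𝓝 0) := by
    have := (hKm.mul hB4).const_mul (u ^ 4)
    rw [mul_zero, mul_zero] at this
    refine this.congr fun n => ?_
    rw [hv4]; ring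
  have herr : Tendsto (fun n : ℕ => ((n / m n : ℕ) : ℝ) *
      ‖φ n - (1 - ((∫ ω, Z n ω ^ 2 ∂P : ℝ) : ℂ) / 2)‖) atTop (𝓝 0) := by
    refine tendsto_zero_of_forall_le (x := fun n : ℕ => 4 * (((n / m n : ℕ) : ℝ) *
      ∫ ω, Z n ω ^ 2 ∂P)) (y := fun n : ℕ => 4 * (((n / m n : ℕ) : ℝ) * ∫ ω, Z n ω ^ 4 ∂P))
      (fun n => by positivity) (hKv.const_mul 4) (by simpa using hKv4.const_mul 4)
      fun δ hδ n => ?_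
    refine (mul_le_mul_of_nonneg_left (norm_integral_exp_sub_le (hZm n) (hZb n) (hZ0 n) hδ)
      (Nat.cast_nonneg _)).trans_eq ?_
    ring
  have hpow := tendsto_pow_exp_of_tendsto (φ := φ)
    (fun n => (norm_integral_le_of_norm_le_const (ae_of_all _ fun ω =>
      (Complex.norm_exp_ofReal_mul_I _).le)).trans (by simp))
    (fun n => integral_nonneg fun ω => sq_nonneg _) hKtop hKv herr
  have hα : Tendsto (fun n : ℕ => ((n / m n : ℕ) : ℝ) * (16 * alphaCoeff P X (r n))) atTop
      (𝓝 0) := by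
    have h1 : Tendsto (fun n : ℕ => 16 * ((n : ℝ) / m n * alphaCoeff P X (r n))) atTop (𝓝 0) := by
      simpa using hkr.const_mul 16
    refine squeeze_zero (fun n => mul_nonneg (Nat.cast_nonneg _)
      (mul_nonneg (by norm_num) (alphaCoeff_nonneg _))) (fun n => ?_) h1
    have h2 := mul_le_mul_of_nonneg_right (Nat.cast_div_le (α := ℝ) (m := n) (n := m n))
      (alphaCoeff_nonneg (P := P) (X := X) (r n))
    linarith
  -- The leftover times are a vanishing proportion of `n`, and m times the sum of the absolute
  -- covariances is at most `K₀`.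
  have hrem : Tendsto (fun n : ℕ => |u| * √((m n : ℝ) / n * ((n - n / m n * (m n - r n) : ℕ) *
      (2 * ∑ h ∈ Finset.range (n + 1), |lagCov P X (D n) h|)))) atTop (𝓝 0) := by
    have h1 : Tendsto (fun n : ℕ => (1 - ((n / m n : ℕ) : ℝ) * (m n / n) *
        (((m n - r n : ℕ) : ℝ) / m n)) * (2 * K₀)) atTop (𝓝 0) := by
      simpa using ((hKm.mul hLm).const_sub 1).mul_const (2 * K₀)
    have h2 : Tendsto (fun n : ℕ => (m n : ℝ) / n * ((n - n / m n * (m n - r n) : ℕ) *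
        (2 * ∑ h ∈ Finset.range (n + 1), |lagCov P X (D n) h|))) atTop (𝓝 0) := by
      refine squeeze_zero' (Eventually.of_forall fun n => ?_) ?_ h1
      · have : 0 ≤ ∑ h ∈ Finset.range (n + 1), |lagCov P X (D n) h| :=
          Finset.sum_nonneg fun _ _ => abs_nonneg _
        positivity
      · filter_upwards [hK, hpos] with n hn hn0
        obtain ⟨ha, hb⟩ := hn0
        have h3 := hn (n + 1)
        have h4 : ∑ h ∈ Finset.range (n + 1), |(m n : ℝ) * lagCov P X (D n) h| =
            m n * ∑ h ∈ Finset.range (n + 1), |lagCov P X (D n) h| := by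
          rw [Finset.mul_sum]
          exact Finset.sum_congr rfl fun h _ => by rw [abs_mul, abs_of_nonneg (Nat.cast_nonneg _)]
        rw [h4] at h3
        have h5 : n / m n * (m n - r n) ≤ n :=
          (Nat.mul_le_mul_left _ (Nat.sub_le _ _)).trans (Nat.div_mul_le_self n (m n))
        have h6 : ((n - n / m n * (m n - r n) : ℕ) : ℝ) / n =
            1 - ((n / m n : ℕ) : ℝ) * (m n / n) * (((m n - r n : ℕ) : ℝ) / m n) := by
          rw [Nat.cast_sub h5, Nat.cast_mul]
          field_simp
        rw [← h6]
        calc _ = ((n - n / m n * (m n - r n) : ℕ) : ℝ) / n *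
              (2 * (m n * ∑ h ∈ Finset.range (n + 1), |lagCov P X (D n) h|)) := by ring
          _ ≤ _ := by gcongr
    have h7 := ((Real.continuous_sqrt.tendsto _).comp h2).const_mul |u|
    simpa using h7
  have hdiff := squeeze_zero_norm' (hle.mono fun n hn =>
    norm_charFun_sub_pow_le (P := P) (n := n) hX hstat (hD n) hn u) (by simpa using hrem.add hα)
  have := hdiff.add hpow
  rw [zero_add] at this
  refine this.congr fun n => ?_
  simp only [hφ, hZ]
  ring

end ArrayLimit

/-! ### Covariances of exceedances: limits and tails -/

section LagCovLimits

variable {Ω : Type*} [MeasurableSpace Ω] {P : Measure Ω} [IsProbabilityMeasure P] {d : ℕ}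
  {X : ℤ → Ω → EuclideanSpace ℝ (Fin d)} {D : ℕ → Set (EuclideanSpace ℝ (Fin d))}
  {a : ℕ → ℝ} {m r : ℕ → ℕ} {τ : ℕ → ℝ} {q : ℝ}

-- The correction by the marginals is m p² = (m p)² / m, which vanishes.
omit [IsProbabilityMeasure P] in
theorem tendsto_mul_lagCov (hm : Tendsto m atTop atTop)
    (hp : Tendsto (fun n => (m n : ℝ) * P.real (X 0 ⁻¹' D n)) atTop (𝓝 q))
    (hjoint : ∀ h : ℕ, Tendsto (fun n => (m n : ℝ) * P.real (X 0 ⁻¹' D n ∩ X h ⁻¹' D n)) atTop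
      (𝓝 (τ h))) (h : ℕ) :
    Tendsto (fun n => (m n : ℝ) * lagCov P X (D n) h) atTop (𝓝 (τ h)) := by
  have hinv : Tendsto (fun n => ((m n : ℝ))⁻¹) atTop (𝓝 0) :=
    tendsto_inv_atTop_zero.comp (tendsto_natCast_atTop_atTop.comp hm)
  have h1 := (hjoint h).sub ((hp.mul hp).mul hinv)
  rw [mul_zero, sub_zero] at h1
  refine h1.congr' ?_
  filter_upwards [hm.eventually_gt_atTop 0] with n hn
  have : (m n : ℝ) ≠ 0 := by positivity
  rw [lagCov]
  field_simp

/-- The lags are split at r_n. Up to r_n a covariance is at most the joint probability, summed by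
anticlustering, plus p², whose total is m (r + 1) p² = (m p)² (r + 1)/m → 0. From r_n on it is at
most α_h. Each of the three parts receives ε/3. -/
theorem ConditionM.lagCov_tail (hstat : StrictlyStationary P X) (hD : ∀ n, MeasurableSet (D n))
    (hM : ConditionM P X a m r) {ε₀ : ℝ} (hε₀ : 0 < ε₀)
    (hDε : ∀ᶠ n in atTop, D n ⊆ {v | ε₀ * a (m n) < ‖v‖})
    (hp : Tendsto (fun n => (m n : ℝ) * P.real (X 0 ⁻¹' D n)) atTop (𝓝 q)) {ε : ℝ} (hε : 0 < ε) :
    ∃ k, ∀ᶠ n in atTop, ∀ N, ∑ h ∈ Finset.Ico k N, |(m n : ℝ) * lagCov P X (D n) h| ≤ ε := by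
  obtain ⟨k, hk⟩ := ((hM.anticlustering ε₀ hε₀).eventually_lt_const
    (show (0 : ℝ≥0∞) < ENNReal.ofReal (ε / 3) by simpa using hε)).exists
  have hk' := eventually_lt_of_limsup_lt hk
  have hsq : Tendsto (fun n => ((m n : ℝ) * P.real (X 0 ⁻¹' D n)) ^ 2 *
      ((r n : ℝ) / m n + 1 / m n)) atTop (𝓝 0) := by
    have h1 : Tendsto (fun n => (1 : ℝ) / m n) atTop (𝓝 0) :=
      tendsto_const_nhds.div_atTop (tendsto_natCast_atTop_atTop.comp hM.m_tendsto)
    simpa using (hp.pow 2).mul (hM.r_div_m.add h1)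
  refine ⟨k, ?_⟩
  filter_upwards [hk', hDε, hsq.eventually_le_const (show (0 : ℝ) < ε / 3 by positivity),
    hM.tail_sum.eventually_le_const (show (0 : ℝ) < ε / 3 by positivity),
    hM.m_tendsto.eventually_gt_atTop 0] with n h1 h2 h3 h4 h5 N
  have hm0 : (0 : ℝ) < m n := by exact_mod_cast h5
  set p := P.real (X 0 ⁻¹' D n) with hp_def
  have hanti : (m n : ℝ) * ∑ h ∈ Finset.Icc k (r n), P.real (X 0 ⁻¹' D n ∩ X h ⁻¹' D n) ≤
      ε / 3 := by
    have e1 : ENNReal.ofReal ((m n : ℝ) *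
        ∑ h ∈ Finset.Icc k (r n), P.real (X 0 ⁻¹' D n ∩ X h ⁻¹' D n)) ≤
        (m n : ℝ≥0∞) * ∑ h ∈ Finset.Icc k (r n),
          P {ω | ε₀ * a (m n) < ‖X h ω‖ ∧ ε₀ * a (m n) < ‖X 0 ω‖} := by
      rw [ENNReal.ofReal_mul hm0.le, ENNReal.ofReal_natCast,
        ENNReal.ofReal_sum_of_nonneg fun _ _ => measureReal_nonneg]
      gcongr with h hh
      rw [ofReal_measureReal]
      exact measure_mono fun ω hω => ⟨h2 hω.2, h2 hω.1⟩
    exact (ENNReal.ofReal_le_ofReal_iff (by positivity)).1 (e1.trans h1.le)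
  have hsub : Finset.Ico k N ⊆ Finset.Icc k (r n) ∪ Finset.Ico (r n) N := fun h hh => by
    simp only [Finset.mem_union, Finset.mem_Ico, Finset.mem_Icc] at hh ⊢
    omega
  have hcard : ((Finset.Icc k (r n)).card : ℝ) ≤ r n + 1 := by
    rw [Nat.card_Icc]
    exact_mod_cast Nat.sub_le _ _
  have hA : ∑ h ∈ Finset.Icc k (r n), |lagCov P X (D n) h| ≤
      ∑ h ∈ Finset.Icc k (r n), P.real (X 0 ⁻¹' D n ∩ X h ⁻¹' D n) + (r n + 1) * p ^ 2 := by
    refine (Finset.sum_le_sum fun h _ => abs_lagCov_le h).trans ?_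
    rw [Finset.sum_add_distrib, Finset.sum_const, nsmul_eq_mul]
    gcongr
  have hB : ∑ h ∈ Finset.Ico (r n) N, |lagCov P X (D n) h| ≤ ∑' j, alphaCoeff P X (r n + j) := by
    rw [Finset.sum_Ico_eq_sum_range]
    refine (Finset.sum_le_sum fun j _ => abs_lagCov_le_alphaCoeff hstat (hD n) (r n + j)).trans ?_
    have hs : Summable fun j => alphaCoeff P X (r n + j) := by
      simpa only [add_comm] using (summable_nat_add_iff (r n)).2 hM.summable
    exact hs.sum_le_tsum _ fun j _ => alphaCoeff_nonneg _
  have hsplit : ∑ h ∈ Finset.Ico k N, |lagCov P X (D n) h| ≤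
      ∑ h ∈ Finset.Icc k (r n), |lagCov P X (D n) h| +
        ∑ h ∈ Finset.Ico (r n) N, |lagCov P X (D n) h| := by
    rw [← Finset.sum_union_inter]
    exact (Finset.sum_le_sum_of_subset_of_nonneg hsub fun _ _ _ => abs_nonneg _).trans
      (le_add_of_nonneg_right (Finset.sum_nonneg fun _ _ => abs_nonneg _))
  have e2 : ∑ h ∈ Finset.Ico k N, |(m n : ℝ) * lagCov P X (D n) h| =
      m n * ∑ h ∈ Finset.Ico k N, |lagCov P X (D n) h| := by
    rw [Finset.mul_sum]
    exact Finset.sum_congr rfl fun h _ => by rw [abs_mul, abs_of_pos hm0]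
  have e3 : ((m n : ℝ) * p) ^ 2 * ((r n : ℝ) / m n + 1 / m n) = m n * ((r n + 1) * p ^ 2) := by
    field_simp
  rw [e3] at h3
  rw [e2]
  have h6 := mul_le_mul_of_nonneg_left (hsplit.trans (add_le_add hA hB)) hm0.le
  linarith

end LagCovLimits

/-! ### The limiting variance as a single series -/

section SigmaSq

variable {d : ℕ} {c : ℕ → ℝ≥0} {μ : (h : ℕ) → Measure (Punctured h d)}
  {C : Set (Fin d → EReal)}

/-- Since c_1 = 1, the term μ(C) is τ at lag 0, and `lagWeight` merges it with the doubled series.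
-/
theorem sigmaSq_eq (hc : c 1 = 1) (hfin : ∀ h, tau c μ C h ≠ ∞)
    (hs : Summable fun h => (tau c μ C h).toReal) :
    sigmaSq c μ C ≠ ∞ ∧
      (sigmaSq c μ C).toReal = ∑' h, lagWeight h * (tau c μ C h).toReal := by
  have h0 : μ 1 (lagSet C 0) = tau c μ C 0 := by
    change _ = (c 1 : ℝ≥0∞) * μ 1 (lagSet C 0)
    rw [hc, ENNReal.coe_one, one_mul]
  have hs1 : Summable fun h => (tau c μ C (h + 1)).toReal :=
    (summable_nat_add_iff (f := fun h => (tau c μ C h).toReal) 1).2 hs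
  have hs2 : ∑' h, tau c μ C (h + 1) ≠ ∞ := by
    have e : ∀ h, tau c μ C (h + 1) = ENNReal.ofReal (tau c μ C (h + 1)).toReal := fun h =>
      (ENNReal.ofReal_toReal (hfin _)).symm
    rw [tsum_congr e]
    exact hs1.tsum_ofReal_ne_top
  have hw : Summable fun h => lagWeight h * (tau c μ C h).toReal :=
    Summable.of_nonneg_of_le (fun h => mul_nonneg (lagWeight_nonneg h) ENNReal.toReal_nonneg)
      (fun h => mul_le_mul_of_nonneg_right (lagWeight_le h) ENNReal.toReal_nonneg) (hs.mul_left 2)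
  have hfin2 : 2 * ∑' h, tau c μ C (h + 1) ≠ ∞ := ENNReal.mul_ne_top (by simp) hs2
  refine ⟨?_, ?_⟩
  · rw [sigmaSq, h0]
    exact ENNReal.add_ne_top.2 ⟨hfin 0, hfin2⟩
  · rw [sigmaSq, h0, ENNReal.toReal_add (hfin 0) hfin2, ENNReal.toReal_mul,
      ENNReal.tsum_toReal_eq fun h => hfin _, hw.tsum_eq_zero_add, ← tsum_mul_left]
    simp [lagWeight]

end SigmaSq

/-! ### Lévy's continuity theorem with a Gaussian limit -/

theorem tendstoInDistribution_gaussianReal_of_charFun {Ω : Type*} [MeasurableSpace Ω]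
    {P : Measure Ω} [IsProbabilityMeasure P] {S : ℕ → Ω → ℝ} (hS : ∀ n, Measurable (S n))
    {v : ℝ≥0} (h : ∀ u : ℝ, Tendsto (fun n => ∫ ω, Complex.exp (((u * S n ω : ℝ) : ℂ) *
      Complex.I) ∂P) atTop (𝓝 (Complex.exp (-(u ^ 2 * v / 2 : ℝ))))) :
    TendstoInDistribution S atTop id (fun _ => P) (gaussianReal 0 v) where
  forall_aemeasurable n := (hS n).aemeasurable
  aemeasurable_limit := aemeasurable_id
  tendsto := by
    refine ProbabilityMeasure.tendsto_iff_tendsto_charFun.2 fun u => ?_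
    simp only [ProbabilityMeasure.coe_mk, Measure.map_id, charFun_gaussianReal]
    convert h u using 1
    · funext n
      rw [charFun_apply_real, integral_map (hS n).aemeasurable (by fun_prop)]
      simp
    · congr 2
      push_cast
      ring

end Extremogram

/-! ### The central limit theorem -/

open Extremogram in
theorem theorem3p2 {Ω : Type*} [MeasurableSpace Ω] (P : Measure Ω) [IsProbabilityMeasure P]
    {d : ℕ} (X : ℤ → Ω → EuclideanSpace ℝ (Fin d)) (hX : ∀ t, Measurable (X t))
    (hstat : StrictlyStationary P X)
    (α : ℝ) (μ : (h : ℕ) → Measure (Punctured h d)) (hreg : RegularlyVarying P X α μ)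
    (a : ℕ → ℝ) (ha : Tendsto (fun n : ℕ => (n : ℝ) * P.real {ω | a n < ‖X 0 ω‖}) atTop (𝓝 1))
    (C : Set (Fin d → EReal)) (hC : MeasurableSet C) (hC0 : BoundedAwayFromZero C)
    (hcont : ∀ h : ℕ, μ (h + 1) (frontier (lagSet C h)) = 0)
    (m r : ℕ → ℕ) (hM : ConditionM P X a m r)
    (hkr : Tendsto (fun n : ℕ => (n : ℝ) / m n * alphaCoeff P X (r n)) atTop (𝓝 0))
    (hgrowth :
      ((fun n : ℕ => (m n : ℝ)) =o[atTop] fun n : ℕ => (n : ℝ) ^ (1 / 3 : ℝ)) ∨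
      (Tendsto (fun n : ℕ => (m n : ℝ) ^ 4 / n * ∑ j ∈ Finset.Icc (r n) (m n), alphaCoeff P X j)
          atTop (𝓝 0) ∧
        Tendsto (fun n : ℕ => (m n : ℝ) * (r n : ℝ) ^ 3 / n) atTop (𝓝 0))) :
    ∃ c : ℕ → ℝ≥0,
      (∀ h, 1 ≤ h → 0 < c h ∧
        Tendsto (fun x : ℝ => P.real {ω | x < lagNorm X h ω} / P.real {ω | x < ‖X 0 ω‖})
          atTop (𝓝 (c h : ℝ))) ∧
      sigmaSq c μ C ≠ ∞ ∧
      TendstoInDistribution (normalizedSum P X a m C) atTop id (fun _ => P)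
        (gaussianReal 0 (sigmaSq c μ C).toNNReal) := by
  have hex : ∀ h : ℕ, ∃ c : ℝ≥0, 1 ≤ h → 0 < c ∧
      Tendsto (fun x : ℝ => P.real {ω | x < lagNorm X h ω} / P.real {ω | x < ‖X 0 ω‖})
        atTop (𝓝 (c : ℝ)) := fun h => by
    by_cases hh : 1 ≤ h
    · obtain ⟨c, hc⟩ := hreg.exists_pos hX hstat hh
      exact ⟨c, fun _ => hc⟩
    -- Nothing is claimed at h = 0, where 0 is a default value.
    · exact ⟨0, fun h1 => absurd h1 hh⟩
  choose c hc using hex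
  have hc1 : c 1 = 1 := by
    have := hreg.const_one hX hstat (hc 1 le_rfl).2
    exact_mod_cast this
  set D : ℕ → Set (EuclideanSpace ℝ (Fin d)) := fun n => {v | scaledPoint (a (m n)) v ∈ C} with hDdef
  have hD : ∀ n, MeasurableSet (D n) := fun n => measurable_scaledPoint _ hC
  have hjt := fun h : ℕ => hreg.tendsto_joint hX hstat ha hC hC0 hM.m_tendsto (hcont h)
    (hc (h + 1) (by omega)).2
  have hjoint : ∀ h : ℕ, Tendsto (fun n => (m n : ℝ) * P.real (X 0 ⁻¹' D n ∩ X h ⁻¹' D n)) atTop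
      (𝓝 (tau c μ C h).toReal) := fun h => (hjt h).1
  have hp : Tendsto (fun n => (m n : ℝ) * P.real (X 0 ⁻¹' D n)) atTop
      (𝓝 (tau c μ C 0).toReal) := by
    have := hjoint 0
    simpa only [Nat.cast_zero, Set.inter_self] using this
  have hfin : ∀ h, tau c μ C h ≠ ∞ := fun h => ENNReal.mul_ne_top ENNReal.coe_ne_top (hjt h).2
  obtain ⟨ε₀, hε₀, hCε⟩ := hC0
  -- Once the threshold is positive, distance of `C` from zero means exceedance in norm, the event
  -- in the anticlustering condition.
  have hDε : ∀ᶠ n in atTop, D n ⊆ {v | ε₀ * a (m n) < ‖v‖} := by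
    filter_upwards [((hreg.threshold_tendsto_atTop hX hstat ha).comp
      hM.m_tendsto).eventually_gt_atTop 0] with n hn v hv
    have h1 : ENNReal.ofReal ε₀ < extNorm (scaledPoint (a (m n)) v) := hCε hv
    have hn' : 0 < a (m n) := hn
    rw [extNorm_scaledPoint hn', ENNReal.ofReal_lt_ofReal_iff_of_nonneg hε₀.le,
      lt_div_iff₀ hn'] at h1
    exact h1
  have hlim := tendsto_mul_lagCov hM.m_tendsto hp hjoint
  have htail : ∀ ε : ℝ, 0 < ε → ∃ k, ∀ᶠ n in atTop, ∀ N, ∑ h ∈ Finset.Ico k N,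
      |(m n : ℝ) * lagCov P X (D n) h| ≤ ε := fun ε hε =>
    hM.lagCov_tail hstat hD hε₀ hDε hp hε
  obtain ⟨hσ, hσeq⟩ := sigmaSq_eq hc1 hfin (summable_of_tail hlim htail)
  have hsum : ∀ n ω, normalizedSum P X a m C n ω =
      √((m n : ℝ) / n) * ∑ t ∈ Finset.Icc 1 n, centred P X (D n) t ω := fun n ω => rfl
  refine ⟨c, hc, hσ, tendstoInDistribution_gaussianReal_of_charFun (fun n => ?_) fun u => ?_⟩
  · simp only [funext (hsum n)]
    exact (measurable_sum_centred hX (hD n) _).const_mul _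
  · have := tendsto_charFun_array hX hstat hD hM.m_tendsto hM.m_div_n hM.r_div_m hkr hp hlim htail
      hgrowth u
    rw [← hσeq] at this
    simp only [hsum]
    exact this
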